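/- **Setting.** Let $\mathcal N$ be a countably infinite multi-sorted set of names, with infinitely many names of each occurring sort. Permutations are the sort-preserving bijections of $\mathcal N$ that move only finitely many names; they act on all objects considered. An object is *finitely supported* if some finite set of names supports it; $\operatorname{supp}(x)$ is its least support, and $a\# x$ means $a\notin\operatorname{supp}(x)$. A *nominal transition system* consists of nominal sets of states, state predicates $\varphi$ and actions $\alpha$, an equivariant relation $P\vdash\varphi$, an equivariant function $\operatorname{bn}$ assigning to each action a finite set $\operatorname{bn}(\alpha)\subseteq\operatorname{supp}(\alpha)$ of binding names, and an equivariant set of transitions $P\xrightarrow{\alpha}P'$, i.e. of pairs of a state $P$ and a name abstraction $\langle\operatorname{bn}(\alpha)\rangle(\alpha,P')$ (an alpha-equivalence class in which $\operatorname{bn}(\alpha)$ is bound). Let $\kappa$ be a cardinal with $\kappa>\aleph_0$ and $\kappa>|\mathrm{States}|$, and let $\nu=\max\{|\mathrm{States}|^+,\aleph_0\}$. **Formulas.** Formulas are $$A ::= \textstyle\bigwedge_{i\in I}A_i \mid \neg A\mid \varphi\mid\langle\alpha\rangle A\mid X\mid \mu X.A ,$$ where conjunctions are over finitely supported sets $\{A_i\}$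 of fewer than $\kappa$ formulas, $\operatorname{bn}(\alpha)$ is bound in $\langle\alpha\rangle A$ (formulas are taken up to the resulting alpha-equivalence), $X$ ranges over countably many equivariant variables, and in $\mu X.A$ every free occurrence of $X$ in $A$ is under an even number of negations. *Plain HML formulas* are those built without $X$ and $\mu X$. Put $\bot=\neg\bigwedge\emptyset$ and $\bigvee_i A_i=\neg\bigwedge_i\neg A_i$. **Semantics.** A *valuation* is a finitely supported map $\varepsilon$ from variables to finitely supported sets of states. The interpretation $[\![A]\!]_\varepsilon$ is given by $[\![\bigwedge_i A_i]\!]_\varepsilon=\bigcap_i[\![A_i]\!]_\varepsilon$, $[\![\neg A]\!]_\varepsilon=\mathrm{States}\setminus[\![A]\!]_\varepsilon$, $[\![\varphi]\!]_\varepsilon=\{P\mid P\vdash\varphi\}$, $[\![X]\!]_\varepsilon=\varepsilon(X)$, $$[\![\langle\alpha\rangle A]\!]_\varepsilon=\{P\mid\exists\alpha',A',P'.\ \langle\alpha\rangle A=\langle\alpha'\rangle A',\ \operatorname{bn}(\alpha')\#P,\varepsilon,\ P\xrightarrow{\alpha'}P',\ P'\in[\![A']\!]_\varepsilon\},$$ $$[\![\mu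 X.A]\!]_\varepsilon=\bigcap\{T\text{ finitely supported}\mid[\![A]\!]_{\varepsilon[X\mapsto T]}\subseteq T\}.$$ Validity $P\models A$ of a plain HML formula is given by the usual clauses ($P\models\langle\alpha\rangle A$ iff for some representative $\langle\alpha'\rangle A'$ of $\langle\alpha\rangle A$ with $\operatorname{bn}(\alpha')\#P$ there is $P'$ with $P\xrightarrow{\alpha'}P'$ and $P'\models A'$). Let $F_A^\varepsilon(T)=[\![A]\!]_{\varepsilon[X\mapsto T]}$, and for a function $F$ on sets of states let $F^0=\emptyset$, $F^{o+1}=F(F^o)$, $F^{l}=\bigcup_{o<l}F^o$ for limit $l$. Let $\mathsf{conv}(\mu X.A,\varepsilon)$ be the least ordinal $o$ such that $(F_A^\varepsilon)^o$ is the least finitely supported fixpoint of $F_A^\varepsilon$, and $\mathsf{Conv}(\mu X.A,E)=\sup_{\varepsilon\in E}\mathsf{conv}(\mu X.A,\varepsilon)$. **Encoding.** Let $\mathsf{unroll}_0(\mu X.A)=\bot$, $\mathsf{unroll}_{o+1}(\mu X.A)=A[\mathsf{unroll}_o(\mu X.A)/X]$ (capture-avoiding), $\mathsf{unroll}_l(\mu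 X.A)=\bigvee_{o<l}\mathsf{unroll}_o(\mu X.A)$ for limit $l$. For a set $E$ of valuations the encoding $\underline{A}_E$ commutes with $\bigwedge$ and $\neg$, leaves $\varphi$ and $X$ unchanged, $\underline{\langle\alpha\rangle A}_E=\langle\alpha\rangle\underline A_E$ for representatives with $\operatorname{bn}(\alpha)\#E$, and $$\underline{\mu X.A}_E=\mathsf{unroll}_\gamma(\mu X.\underline A_{E'}),\quad E'=\{\varepsilon[X\mapsto(F_A^\varepsilon)^o]\mid\varepsilon\in E,\ o\le\mathsf{conv}(\mu X.A,\varepsilon)\},\quad \gamma=\mathsf{Conv}(\mu X.\underline A_{E'},E).$$ **Theorem.** Let $E$ be a non-empty, finitely supported set of valuations with $|E|<\nu$. 1. For every formula $A$, the clauses above determine a unique $\underline A_E$, and it is a formula without fixpoint operators; if $A$ is closed, it is a plain HML formula. For every formula $\mu X.A$, $\mu X.\underline A_{E'}$ is a formula and the ordinal $\gamma$ above satisfies $\gamma<\nu$. 2. For every formula $A$ and every $\varepsilon\in E$, $[\![\underline A_E]\!]_\varepsilon=[\![A]\!]_\varepsilon$. Consequently, every closed formula is equivalent to a plain HML formula: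 if $A$ is closed and $\underline A=\underline A_{\{\varepsilon_\emptyset\}}$, where $\varepsilon_\emptyset(X)=\emptyset$ for all $X$, then $\underline A$ is a plain HML formula and, for every valuation $\varepsilon$ and state $P$, $P\models\underline A$ if and only if $P\in[\![A]\!]_\varepsilon$. -/

import Mathlib

open Cardinal Ordinal
open scoped Pointwise

universe u v

namespace NomHML

/-! ## Names, permutations, nominal sets -/

/-- A countably infinite multi-sorted set of names; there are infinitely many names of each sort
that occurs, so that fresh names of that sort are always available. -/
class NameSpace (𝒩 : Type u) where
  Srt : Type u
  sort : 𝒩 → Srt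
  countable : Countable 𝒩
  nonempty : Nonempty 𝒩
  infinite_sort : ∀ a : 𝒩, {b : 𝒩 | sort b = sort a}.Infinite

/-- The group of sort-preserving bijections on names that fix all but finitely many names. -/
def NPerm (𝒩 : Type u) [NameSpace 𝒩] : Subgroup (Equiv.Perm 𝒩) where
  carrier := {π | {a | π a ≠ a}.Finite ∧ ∀ a, NameSpace.sort (π a) = NameSpace.sort a}
  one_mem' := by simp
  mul_mem' := by
    rintro π ρ ⟨h1, h2⟩ ⟨h3, h4⟩
    refine ⟨(h1.union h3).subset ?_, fun a => by simp [h2, h4]⟩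
    intro a ha
    by_contra hn
    have h5 : π a = a := by by_contra h; exact hn (Or.inl h)
    have h6 : ρ a = a := by by_contra h; exact hn (Or.inr h)
    exact ha (by rw [Equiv.Perm.mul_apply, h6, h5])
  inv_mem' := by
    rintro π ⟨h1, h2⟩
    refine ⟨h1.subset ?_, fun a => by simpa using (h2 (π⁻¹ a)).symm⟩
    intro a ha h
    exact ha (by rw [Equiv.Perm.inv_eq_iff_eq]; exact h.symm)

section Support

variable (𝒩 : Type u) [NameSpace 𝒩] {X : Type*} [MulAction (NPerm 𝒩) X]

/-- `x` is supported by some finite set of names. -/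
def FinSupp (x : X) : Prop :=
  ∃ N : Finset 𝒩, MulAction.Supports (NPerm 𝒩) (N : Set 𝒩) x

/-- The support of `x`: the intersection of all finite sets that support `x` (for a finitely
supported `x`, this is the least supporting set). -/
def supp (x : X) : Set 𝒩 :=
  {a | ∀ N : Finset 𝒩, MulAction.Supports (NPerm 𝒩) (N : Set 𝒩) x → a ∈ N}

variable {𝒩}

/-- `N # x`: all names in `N` are fresh for `x`. -/
def Fresh (N : Set 𝒩) (x : X) : Prop := ∀ a ∈ N, a ∉ supp 𝒩 x

theorem supports_smul {N : Finset 𝒩} {x : X} (π : NPerm 𝒩)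
    (h : MulAction.Supports (NPerm 𝒩) (N : Set 𝒩) x) :
    MulAction.Supports (NPerm 𝒩)
      ((N.map (π : Equiv.Perm 𝒩).toEmbedding : Finset 𝒩) : Set 𝒩) (π • x) := by
  intro g hg
  have key : (π⁻¹ * g * π) • x = x := h _ (fun a ha => by
    have h1 : g • (π • a) = π • a := hg (by
      simp only [Finset.coe_map, Set.mem_image]
      exact ⟨a, ha, rfl⟩)
    rw [mul_smul, mul_smul, h1, inv_smul_smul])
  rw [mul_smul, mul_smul, inv_smul_eq_iff] at key
  exact key

theorem mem_supp_of_smul {a : 𝒩} {x : X} {π : NPerm 𝒩}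
    (ha : a ∈ supp 𝒩 (π • x)) : π⁻¹ • a ∈ supp 𝒩 x := by
  intro N hN
  have h := ha _ (supports_smul π hN)
  simp only [Finset.mem_map] at h
  obtain ⟨b, hb, rfl⟩ := h
  have : π⁻¹ • ((π : Equiv.Perm 𝒩).toEmbedding b) = b := inv_smul_smul π b
  rwa [this]

end Support

/-- A nominal set: a set with a permutation action all of whose elements have finite support. -/
class NominalSet (𝒩 : Type u) [NameSpace 𝒩] (X : Type u) extends MulAction (NPerm 𝒩) X where
  finSupp : ∀ x : X, FinSupp 𝒩 x

/-- Nominal alpha-equivalence on pairs `(N, x)` of a finite set of (bound) names and an object. -/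
def nameAbsSetoid (𝒩 : Type u) [NameSpace 𝒩] (X : Type v) [MulAction (NPerm 𝒩) X] :
    Setoid (Finset 𝒩 × X) where
  r p q := ∃ π : NPerm 𝒩, (q.1 : Set 𝒩) = π • (p.1 : Set 𝒩) ∧ q.2 = π • p.2 ∧
    ∀ a ∈ supp 𝒩 p.2 \ (p.1 : Set 𝒩), π • a = a
  iseqv := by
    refine ⟨fun p => ⟨1, by simp, by simp, by simp⟩, ?_, ?_⟩
    · rintro ⟨N, x⟩ ⟨M, y⟩ ⟨π, h1, h2, h3⟩
      simp only at h1 h2 h3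
      refine ⟨π⁻¹, by simp [h1], by simp [h2], ?_⟩
      rintro a ⟨ha1, ha2⟩
      simp only at ha1 ha2
      rw [h2] at ha1
      rw [h1, Set.mem_smul_set_iff_inv_smul_mem] at ha2
      have := h3 _ ⟨mem_supp_of_smul ha1, ha2⟩
      rw [smul_inv_smul] at this
      exact this.symm
    · rintro ⟨N, x⟩ ⟨M, y⟩ ⟨K, z⟩ ⟨π, h1, h2, h3⟩ ⟨ρ, h4, h5, h6⟩
      simp only at *
      refine ⟨ρ * π, by rw [h4, h1, mul_smul], by rw [h5, h2, mul_smul], ?_⟩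
      rintro a ⟨ha1, ha2⟩
      have e := h3 a ⟨ha1, ha2⟩
      have e' : π⁻¹ • a = a := by rw [inv_smul_eq_iff, e]
      rw [mul_smul, e]
      refine h6 a ⟨?_, ?_⟩
      · rw [h2]
        intro L hL
        have hL' := supports_smul π⁻¹ hL
        rw [inv_smul_smul] at hL'
        have hm := ha1 _ hL'
        simp only [Finset.mem_map] at hm
        obtain ⟨b, hb, hba⟩ := hm
        have hb' : π⁻¹ • b = a := hba
        rw [inv_smul_eq_iff, e] at hb'
        rwa [← hb']
      · rw [h1, Set.mem_smul_set_iff_inv_smul_mem, e']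
        exact ha2

/-- Generalised name abstraction: the set of classes `⟨N⟩x` with `N` a finite set of names. -/
def NameAbs (𝒩 : Type u) [NameSpace 𝒩] (X : Type v) [MulAction (NPerm 𝒩) X] :
    Type (max u v) :=
  Quotient (nameAbsSetoid 𝒩 X)

/-- The class `⟨N⟩x` of the pair `(N, x)`. -/
def NameAbs.mk {𝒩 : Type u} [NameSpace 𝒩] {X : Type v} [MulAction (NPerm 𝒩) X]
    (N : Finset 𝒩) (x : X) : NameAbs 𝒩 X :=
  Quotient.mk (nameAbsSetoid 𝒩 X) (N, x)

/-! ## Nominal transition systems -/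

/-- A nominal transition system. -/
structure NTS (𝒩 : Type u) [NameSpace 𝒩] where
  State : Type u
  Pred : Type u
  Act : Type u
  [nominalState : NominalSet 𝒩 State]
  [nominalPred : NominalSet 𝒩 Pred]
  [nominalAct : NominalSet 𝒩 Act]
  /-- `Entails P φ`: the state predicate `φ` holds in the state `P`. -/
  Entails : State → Pred → Prop
  entails_smul : ∀ (π : NPerm 𝒩) P φ, Entails P φ → Entails (π • P) (π • φ)
  /-- The binding names of an action. -/
  bn : Act → Finset 𝒩
  bn_smul : ∀ (π : NPerm 𝒩) α, (bn (π • α) : Set 𝒩) = π • (bn α : Set 𝒩)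
  bn_subset : ∀ α, (bn α : Set 𝒩) ⊆ supp 𝒩 α
  /-- The transition relation, a set of pairs of a state and a residual `⟨N⟩(α, Q)`. -/
  trans : Set (State × NameAbs 𝒩 (Act × State))
  trans_smul : ∀ (π : NPerm 𝒩) P (N N' : Finset 𝒩) α Q, (N' : Set 𝒩) = π • (N : Set 𝒩) →
    (P, NameAbs.mk N (α, Q)) ∈ trans → (π • P, NameAbs.mk N' (π • α, π • Q)) ∈ trans
  bn_eq_of_trans : ∀ P N α Q, (P, NameAbs.mk N (α, Q)) ∈ trans → bn α = N

attribute [instance] NTS.nominalState NTS.nominalPred NTS.nominalAct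

section Formulas

variable {𝒩 : Type u} [NameSpace 𝒩] (S : NTS 𝒩)

/-- `Step S P α Q`: there is a transition `P --α--> Q`. -/
def Step (P : S.State) (α : S.Act) (Q : S.State) : Prop :=
  (P, NameAbs.mk (S.bn α) (α, Q)) ∈ S.trans

/-! ## Formulas

Raw formulas are trees without any identification. Formulas are equivalence classes of raw
formulas; in these, a conjunction depends only on the set of its conjuncts and the names `bn α`
are bound in `⟨α⟩A`. -/

/-- Raw formulas, with variables `X` numbered by natural numbers. -/
inductive Raw : Type (u + 1)
  | conj (ι : Type u) (R : ι → Raw) : Raw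
  | neg (R : Raw) : Raw
  | pred (φ : S.Pred) : Raw
  | dia (α : S.Act) (R : Raw) : Raw
  | var (X : ℕ) : Raw
  | mu (X : ℕ) (R : Raw) : Raw

variable {S}

namespace Raw

/-- Name permutation distributes over all constructors; variables are equivariant. -/
def perm (π : NPerm 𝒩) : Raw S → Raw S
  | conj ι R => conj ι fun i => perm π (R i)
  | neg R => neg (perm π R)
  | pred φ => pred (π • φ)
  | dia α R => dia (π • α) (perm π R)
  | var X => var X
  | mu X R => mu X (perm π R)

instance : MulAction (NPerm 𝒩) (Raw S) where
  smul := perm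
  one_smul R := by
    change perm 1 R = R
    induction R <;> simp_all [perm]
  mul_smul π ρ R := by
    change perm (π * ρ) R = perm π (perm ρ R)
    induction R <;> simp_all [perm, mul_smul]

/-- Alpha-equivalence of raw formulas. Conjunctions are compared as sets of conjuncts. In the
clause for `⟨α⟩R` there has to be a permutation `π` with `π • α = β` and `π • R ≈ R'` that fixes
every name in `(supp α ∪ supp [R]) \ bn α`; here `[R]` is the class of `R`, and
`a ∉ supp [R]` is expressed by a finite set `N a` of names that supports `[R]` with `a ∉ N a`. -/
inductive Alpha : Raw S → Raw S → Prop
  | conj {ι κ : Type u} {R : ι → Raw S} {R' : κ → Raw S} (f : ι → κ) (g : κ → ι)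
      (hf : ∀ i, Alpha (R i) (R' (f i))) (hg : ∀ j, Alpha (R (g j)) (R' j)) :
      Alpha (conj ι R) (conj κ R')
  | neg {R R' : Raw S} : Alpha R R' → Alpha (neg R) (neg R')
  | pred (φ : S.Pred) : Alpha (pred φ) (pred φ)
  | dia {α β : S.Act} {R R' : Raw S} (π : NPerm 𝒩) (N : 𝒩 → Finset 𝒩)
      (hα : π • α = β) (hR : Alpha (π • R) R')
      (hN : ∀ a ∉ S.bn α, π • a ≠ a →
        ∀ σ : NPerm 𝒩, (∀ b ∈ N a, σ • b = b) → Alpha (σ • R) R)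
      (hfix : ∀ a ∉ S.bn α, π • a ≠ a → a ∉ supp 𝒩 α ∧ a ∉ N a) :
      Alpha (dia α R) (dia β R')
  | var (X : ℕ) : Alpha (var X) (var X)
  | mu (X : ℕ) {R R' : Raw S} : Alpha R R' → Alpha (mu X R) (mu X R')

theorem Alpha.refl (R : Raw S) : Alpha R R := by
  induction R with
  | conj ι R ih => exact .conj id id ih ih
  | neg R ih => exact .neg ih
  | pred φ => exact .pred φ
  | dia α R ih =>
    exact .dia 1 (fun _ => ∅) (one_smul _ _) (by rwa [one_smul])
      (fun a _ h => absurd (one_smul (NPerm 𝒩) a) h)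
      (fun a _ h => absurd (one_smul (NPerm 𝒩) a) h)
  | var X => exact .var X
  | mu X R ih => exact .mu X ih

theorem notMem_supp_smul {X : Type*} [MulAction (NPerm 𝒩) X] {a : 𝒩} {x : X} {π : NPerm 𝒩}
    (ha : π⁻¹ • a ∉ supp 𝒩 x) : a ∉ supp 𝒩 (π • x) := fun h => ha (mem_supp_of_smul h)

theorem notMem_bn {α : S.Act} {π : NPerm 𝒩} {a : 𝒩} (h : a ∉ S.bn (π • α)) :
    π⁻¹ • a ∉ S.bn α := by
  intro h'
  apply h
  have : a ∈ (S.bn (π • α) : Set 𝒩) := by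
    rw [S.bn_smul, Set.mem_smul_set_iff_inv_smul_mem]
    exact h'
  exact this

theorem notMem_map {N : Finset 𝒩} {π : NPerm 𝒩} {a : 𝒩} (h : π⁻¹ • a ∉ N) :
    a ∉ N.map (π : Equiv.Perm 𝒩).toEmbedding := by
  intro h'
  obtain ⟨b, hb, rfl⟩ := Finset.mem_map.1 h'
  apply h
  have : π⁻¹ • ((π : Equiv.Perm 𝒩).toEmbedding b) = b := inv_smul_smul π b
  rwa [this]

theorem conj_fix {N : Finset 𝒩} {π σ : NPerm 𝒩}
    (h : ∀ b : 𝒩, b ∈ N.map (π : Equiv.Perm 𝒩).toEmbedding → σ • b = b) :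
    ∀ b ∈ N, (π⁻¹ * σ * π) • b = b := by
  intro b hb
  have h1 : σ • (π • b) = π • b := h _ (Finset.mem_map.2 ⟨b, hb, rfl⟩)
  rw [mul_smul, mul_smul, h1, inv_smul_smul]

theorem Alpha.smul {R R' : Raw S} (h : Alpha R R') (π : NPerm 𝒩) : Alpha (π • R) (π • R') := by
  induction h generalizing π with
  | conj f g _ _ ihf ihg => exact .conj f g (fun i => ihf i π) (fun j => ihg j π)
  | neg _ ih => exact .neg (ih π)
  | pred φ => exact .pred _
  | var X => exact .var X
  | mu X _ ih => exact .mu X (ih π)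
  | @dia α β R R' ρ N hα hR hN hfix ihR ihN =>
    have ne : ∀ a : 𝒩, (π * ρ * π⁻¹) • a ≠ a → ρ • (π⁻¹ • a) ≠ π⁻¹ • a := by
      intro a h1 h2
      apply h1
      rw [mul_smul, mul_smul, h2, smul_inv_smul]
    refine .dia (π * ρ * π⁻¹)
      (fun a => (N (π⁻¹ • a)).map (π : Equiv.Perm 𝒩).toEmbedding) ?_ ?_ ?_ ?_
    · rw [mul_smul, mul_smul, inv_smul_smul, hα]
    · have e : (π * ρ * π⁻¹) • (π • R) = π • ρ • R := by
        rw [mul_smul, mul_smul, inv_smul_smul]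
      change Alpha ((π * ρ * π⁻¹) • (π • R)) (π • R')
      rw [e]
      exact ihR π
    · intro a ha hne σ hσ
      have e := ihN _ (notMem_bn ha) (ne a hne) _ (conj_fix hσ) π
      have e2 : π • (π⁻¹ * σ * π) • R = σ • π • R := by
        rw [mul_smul, mul_smul, smul_inv_smul]
      rw [e2] at e
      exact e
    · intro a ha hne
      obtain ⟨h1, h2⟩ := hfix _ (notMem_bn ha) (ne a hne)
      exact ⟨notMem_supp_smul h1, notMem_map h2⟩

theorem Alpha.euclidean (R : Raw S) :
    ∀ {S₁ T₁ : Raw S}, Alpha R S₁ → Alpha R T₁ → Alpha S₁ T₁ := by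
  induction R with
  | conj ι R ih =>
    intro S₁ T₁ h1 h2
    cases h1 with
    | conj f g hf hg =>
      cases h2 with
      | conj f' g' hf' hg' =>
        exact .conj (fun j => f' (g j)) (fun k => f (g' k))
          (fun j => ih _ (hg j) (hf' _)) (fun k => ih _ (hf _) (hg' k))
  | neg R ih =>
    intro S₁ T₁ h1 h2
    cases h1 with
    | neg h1 => cases h2 with
      | neg h2 => exact .neg (ih h1 h2)
  | pred φ =>
    intro S₁ T₁ h1 h2
    cases h1
    exact h2
  | var X =>
    intro S₁ T₁ h1 h2
    cases h1
    exact h2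
  | mu X R ih =>
    intro S₁ T₁ h1 h2
    cases h1 with
    | mu _ h1 => cases h2 with
      | mu _ h2 => exact .mu X (ih h1 h2)
  | dia α R ih =>
    intro S₁ T₁ h1 h2
    have ihπ : ∀ (π : NPerm 𝒩) {Y Z : Raw S}, Alpha (π • R) Y → Alpha (π • R) Z → Alpha Y Z := by
      intro π Y Z hY hZ
      have hY' := hY.smul π⁻¹
      have hZ' := hZ.smul π⁻¹
      rw [inv_smul_smul] at hY' hZ'
      have := (ih hY' hZ').smul π
      rwa [smul_inv_smul, smul_inv_smul] at this
    cases h1 with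
    | @dia _ β _ R₁ ρ N hα hR hN hfix =>
    cases h2 with
    | @dia _ γ _ R₂ τ M hα' hR' hN' hfix' =>
    classical
    -- `K b` is a finite support of the class of `R` that omits `b`, when `ρ` or `τ` moves `b`
    let K : 𝒩 → Finset 𝒩 := fun b => if ρ • b ≠ b then N b else M b
    have mv : ∀ a, a ∉ S.bn β → (τ * ρ⁻¹) • a ≠ a →
        ρ⁻¹ • a ∉ S.bn α ∧ (ρ • (ρ⁻¹ • a) ≠ ρ⁻¹ • a ∨ τ • (ρ⁻¹ • a) ≠ ρ⁻¹ • a) := by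
      intro a ha hne
      refine ⟨notMem_bn (by rwa [hα]), ?_⟩
      by_contra hcon
      simp only [not_or, not_not] at hcon
      apply hne
      have e := hcon.1
      rw [smul_inv_smul] at e
      rw [mul_smul, hcon.2, ← e]
    have hK : ∀ b ∉ S.bn α, (ρ • b ≠ b ∨ τ • b ≠ b) →
        (∀ σ : NPerm 𝒩, (∀ c ∈ K b, σ • c = c) → Alpha (σ • R) R) ∧
          b ∉ supp 𝒩 α ∧ b ∉ K b := by
      intro b hb hm
      by_cases hρ : ρ • b ≠ b
      · have e : K b = N b := if_pos hρ
        rw [e]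
        exact ⟨hN b hb hρ, hfix b hb hρ⟩
      · have e : K b = M b := if_neg hρ
        rw [e]
        have hτ := hm.resolve_left hρ
        exact ⟨hN' b hb hτ, hfix' b hb hτ⟩
    refine .dia (τ * ρ⁻¹)
      (fun a => (K (ρ⁻¹ • a)).map (ρ : Equiv.Perm 𝒩).toEmbedding) ?_ ?_ ?_ ?_
    · rw [mul_smul, ← hα, inv_smul_smul, hα']
    · have e := hR.smul (τ * ρ⁻¹)
      rw [mul_smul, inv_smul_smul] at e
      exact ihπ τ e hR'
    · intro a ha hne σ hσ
      obtain ⟨m1, m2⟩ := mv a ha hne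
      have e := ((hK _ m1 m2).1 _ (conj_fix hσ)).smul ρ
      have e2 : ρ • (ρ⁻¹ * σ * ρ) • R = σ • ρ • R := by
        rw [mul_smul, mul_smul, smul_inv_smul]
      rw [e2] at e
      -- `σ • ρ • R ≈ ρ • R`, and both sides transport along `ρ • R ≈ R₁`
      have e3 : Alpha (σ • ρ • R) R₁ := by
        have := ihπ (σ * ρ) (by rw [mul_smul]; exact e) (by rw [mul_smul]; exact Alpha.refl _)
        exact ihπ ρ (this) hR
      exact ihπ (σ * ρ) (by rw [mul_smul]; exact hR.smul σ) (by rw [mul_smul]; exact e3)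
    · intro a ha hne
      obtain ⟨m1, m2⟩ := mv a ha hne
      obtain ⟨-, k1, k2⟩ := hK _ m1 m2
      refine ⟨?_, notMem_map k2⟩
      rw [← hα]
      exact notMem_supp_smul k1

theorem Alpha.symm {R R' : Raw S} (h : Alpha R R') : Alpha R' R :=
  Alpha.euclidean R h (Alpha.refl R)

theorem Alpha.trans {R R' R'' : Raw S} (h : Alpha R R') (h' : Alpha R' R'') : Alpha R R'' :=
  Alpha.euclidean R' h.symm h'

variable (S) in
def setoid : Setoid (Raw S) := ⟨Alpha, Alpha.refl, Alpha.symm, Alpha.trans⟩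

/-- The height of a raw formula; only used to justify recursion up to alpha-equivalence. -/
noncomputable def rank : Raw S → Ordinal.{u}
  | conj _ R => ⨆ i, (rank (R i) + 1)
  | neg R => rank R + 1
  | pred _ => 0
  | dia _ R => rank R + 1
  | var _ => 0
  | mu _ R => rank R + 1

theorem rank_smul (π : NPerm 𝒩) (R : Raw S) : rank (π • R) = rank R := by
  change rank (perm π R) = rank R
  induction R <;> simp_all [perm, rank]

theorem Alpha.rank_eq {R R' : Raw S} (h : Alpha R R') : rank R = rank R' := by
  induction h with
  | conj f g _ _ ihf ihg =>
    simp only [rank]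
    apply le_antisymm
    · exact Ordinal.iSup_le fun i => by
        rw [ihf i]; exact Ordinal.le_iSup (fun j => rank _ + 1) (f i)
    · exact Ordinal.iSup_le fun j => by
        rw [← ihg j]; exact Ordinal.le_iSup (fun i => rank _ + 1) (g j)
  | neg _ ih => simp [rank, ih]
  | pred => rfl
  | dia π _ _ _ _ _ ih _ => rw [rank_smul] at ih; simp [rank, ih]
  | var => rfl
  | mu _ _ ih => simp [rank, ih]

theorem rank_conj_lt {ι : Type u} (R : ι → Raw S) (i : ι) : rank (R i) < rank (conj ι R) := by
  simp only [rank]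
  exact lt_of_lt_of_le (lt_add_one _) (Ordinal.le_iSup (fun i => rank (R i) + 1) i)

theorem rank_dia_lt {α α' : S.Act} {R R' : Raw S} (h : Alpha (dia α R) (dia α' R')) :
    rank R' < rank (dia α R) := by
  rw [h.rank_eq]
  simp only [rank]
  exact lt_add_one _

/-- The interpretation of a raw formula under the valuation `ε`, a set of states. -/
def interp (R : Raw S) (ε : ℕ → Set S.State) : Set S.State :=
  match R with
  | conj _ R => ⋂ i, interp (R i) ε
  | neg R => (interp R ε)ᶜ
  | pred φ => {P | S.Entails P φ}
  | dia α R => {P | ∃ α' R' P', ∃ _ : Alpha (dia α R) (dia α' R'),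
      Fresh (S.bn α' : Set 𝒩) P ∧ Fresh (S.bn α' : Set 𝒩) ε ∧ Step S P α' P' ∧ P' ∈ interp R' ε}
  | var X => ε X
  | mu X R => ⋂₀ {T | FinSupp 𝒩 T ∧ interp R (Function.update ε X T) ⊆ T}
termination_by rank R
decreasing_by
  · exact rank_conj_lt _ _
  · simp [rank]
  · exact rank_dia_lt ‹_›
  · simp [rank]

/-- Validity of a raw formula of plain HML in a state. Variables and fixpoint operators do not
occur in plain HML; the last two clauses are irrelevant. -/
def Valid (P : S.State) (R : Raw S) : Prop :=
  match R with
  | conj _ R => ∀ i, Valid P (R i)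
  | neg R => ¬ Valid P R
  | pred φ => S.Entails P φ
  | dia α R => ∃ α' R' P', ∃ _ : Alpha (dia α R) (dia α' R'),
      Fresh (S.bn α' : Set 𝒩) P ∧ Step S P α' P' ∧ Valid P' R'
  | var _ => False
  | mu _ _ => False
termination_by rank R
decreasing_by
  · exact rank_conj_lt _ _
  · simp [rank]
  · exact rank_dia_lt ‹_›

theorem interp_congr {R R' : Raw S} (h : Alpha R R') :
    ∀ ε : ℕ → Set S.State, interp R ε = interp R' ε := by
  induction h with
  | conj f g _ _ ihf ihg =>
    intro ε
    simp only [interp]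
    ext P
    simp only [Set.mem_iInter]
    exact ⟨fun H j => ihg j ε ▸ H (g j), fun H i => (ihf i ε).symm ▸ H (f i)⟩
  | neg _ ih => intro ε; simp only [interp, ih]
  | pred => intro ε; rfl
  | dia π N hα hR hN hfix _ _ =>
    intro ε
    have h := Alpha.dia π N hα hR hN hfix
    simp only [interp]
    ext P
    constructor
    · rintro ⟨α', R', P', h', hh⟩
      exact ⟨α', R', P', h.symm.trans h', hh⟩
    · rintro ⟨α', R', P', h', hh⟩
      exact ⟨α', R', P', h.trans h', hh⟩
  | var => intro ε; rfl
  | mu _ _ ih => intro ε; simp only [interp, ih]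

theorem valid_congr {R R' : Raw S} (h : Alpha R R') :
    ∀ P : S.State, Valid P R ↔ Valid P R' := by
  induction h with
  | conj f g _ _ ihf ihg =>
    intro P
    simp only [Valid]
    exact ⟨fun H j => (ihg j P).1 (H (g j)), fun H i => (ihf i P).2 (H (f i))⟩
  | neg _ ih => intro P; simp only [Valid, ih]
  | pred => intro P; rfl
  | dia π N hα hR hN hfix _ _ =>
    intro P
    have h := Alpha.dia π N hα hR hN hfix
    simp only [Valid]
    constructor
    · rintro ⟨α', R', P', h', hh⟩
      exact ⟨α', R', P', h.symm.trans h', hh⟩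
    · rintro ⟨α', R', P', h', hh⟩
      exact ⟨α', R', P', h.trans h', hh⟩
  | var => intro P; rfl
  | mu _ _ ih => intro P; simp only [Valid]

end Raw

variable (S) in
/-- Raw formulas modulo alpha-equivalence. The formulas are those that satisfy `IsFormula`. -/
def PreFormula : Type (u + 1) := Quotient (Raw.setoid S)

namespace PreFormula

instance : MulAction (NPerm 𝒩) (PreFormula S) where
  smul π := Quotient.map (π • ·) fun _ _ h => Raw.Alpha.smul h π
  one_smul A := by
    induction A using Quotient.inductionOn with
    | h R => exact congrArg (Quotient.mk _) (one_smul _ R)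
  mul_smul π ρ A := by
    induction A using Quotient.inductionOn with
    | h R => exact congrArg (Quotient.mk _) (mul_smul π ρ R)

noncomputable def conj {ι : Type u} (A : ι → PreFormula S) : PreFormula S :=
  Quotient.mk _ (Raw.conj ι fun i => (A i).out)

def neg : PreFormula S → PreFormula S := Quotient.map Raw.neg fun _ _ h => .neg h

def pred (φ : S.Pred) : PreFormula S := Quotient.mk _ (Raw.pred φ)

/-- The formula `⟨α⟩A`, in which the names `bn α` are bound. -/
def dia (α : S.Act) : PreFormula S → PreFormula S :=
  Quotient.map (Raw.dia α) fun R R' h =>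
    .dia 1 (fun _ => ∅) (one_smul _ α) (by rw [one_smul]; exact h)
      (fun a _ h => absurd (one_smul (NPerm 𝒩) a) h)
      (fun a _ h => absurd (one_smul (NPerm 𝒩) a) h)

def var (X : ℕ) : PreFormula S := Quotient.mk _ (Raw.var X)

def mu (X : ℕ) : PreFormula S → PreFormula S := Quotient.map (Raw.mu X) fun _ _ h => .mu X h

/-- The formula `⊥`, the negation of the empty conjunction. -/
noncomputable def bot : PreFormula S := neg (conj (PEmpty.elim : PEmpty.{u + 1} → PreFormula S))

noncomputable def disj {ι : Type u} (A : ι → PreFormula S) : PreFormula S :=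
  neg (conj fun i => neg (A i))

/-- `Occurs X b A`: the variable `X` has a free occurrence in `A` in the scope of an even
(`b = true`) or odd (`b = false`) number of negations. -/
inductive Occurs (X : ℕ) : Bool → PreFormula S → Prop
  | conj {ι : Type u} {A : ι → PreFormula S} {b : Bool} (i : ι) :
      Occurs X b (A i) → Occurs X b (conj A)
  | neg {A : PreFormula S} {b : Bool} : Occurs X b A → Occurs X (!b) (neg A)
  | dia {α : S.Act} {A : PreFormula S} {b : Bool} : Occurs X b A → Occurs X b (dia α A)
  | var : Occurs X true (var X)
  | mu {Y : ℕ} {A : PreFormula S} {b : Bool} : Y ≠ X → Occurs X b A → Occurs X b (mu Y A)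

/-- The variable `X` is free in `A`. -/
def FreeIn (X : ℕ) (A : PreFormula S) : Prop := ∃ b, Occurs X b A

/-- No variable is free in `A`. -/
def Closed (A : PreFormula S) : Prop := ∀ X, ¬ FreeIn X A

/-- The formulas of the logic with least fixpoint operators: conjunctions are over finitely
supported sets of fewer than `κ` formulas, and in `μX.A` the variable `X` is positive in `A`. -/
inductive IsFormula (κ : Cardinal.{u}) : PreFormula S → Prop
  | conj {ι : Type u} {A : ι → PreFormula S} (hι : #ι < κ) (hfs : FinSupp 𝒩 (Set.range A))
      (hA : ∀ i, IsFormula κ (A i)) : IsFormula κ (conj A)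
  | neg {A : PreFormula S} : IsFormula κ A → IsFormula κ (neg A)
  | pred (φ : S.Pred) : IsFormula κ (pred φ)
  | dia (α : S.Act) {A : PreFormula S} : IsFormula κ A → IsFormula κ (dia α A)
  | var (X : ℕ) : IsFormula κ (var X)
  | mu (X : ℕ) {A : PreFormula S} (hpos : ¬ Occurs X false A) :
      IsFormula κ A → IsFormula κ (mu X A)

/-- The formulas of plain Hennessy-Milner logic, without variables and fixpoint operators. -/
inductive IsHML (κ : Cardinal.{u}) : PreFormula S → Prop
  | conj {ι : Type u} {A : ι → PreFormula S} (hι : #ι < κ) (hfs : FinSupp 𝒩 (Set.range A))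
      (hA : ∀ i, IsHML κ (A i)) : IsHML κ (conj A)
  | neg {A : PreFormula S} : IsHML κ A → IsHML κ (neg A)
  | pred (φ : S.Pred) : IsHML κ (pred φ)
  | dia (α : S.Act) {A : PreFormula S} : IsHML κ A → IsHML κ (dia α A)

/-- `A` contains no fixpoint operator. -/
inductive FixFree : PreFormula S → Prop
  | conj {ι : Type u} {A : ι → PreFormula S} (hA : ∀ i, FixFree (A i)) : FixFree (conj A)
  | neg {A : PreFormula S} : FixFree A → FixFree (neg A)
  | pred (φ : S.Pred) : FixFree (pred φ)
  | dia (α : S.Act) {A : PreFormula S} : FixFree A → FixFree (dia α A)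
  | var (X : ℕ) : FixFree (var X)

/-! ## Semantics -/

/-- Validity `P ⊨ A` of a formula of plain Hennessy-Milner logic. -/
def Valid (P : S.State) : PreFormula S → Prop :=
  Quotient.lift (Raw.Valid P) fun _ _ h => propext (Raw.valid_congr h P)

/-- The interpretation `⟦A⟧_ε`. -/
def interp (A : PreFormula S) (ε : ℕ → Set S.State) : Set S.State :=
  Quotient.lift (fun R => Raw.interp R ε) (fun _ _ h => Raw.interp_congr h ε) A

/-- The function `F_A^ε : T ↦ ⟦A⟧_{ε[X ↦ T]}`. -/
def step (X : ℕ) (A : PreFormula S) (ε : ℕ → Set S.State) (T : Set S.State) : Set S.State :=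
  interp A (Function.update ε X T)

end PreFormula

open PreFormula

/-- A valuation is a finitely supported map from variables to sets of states. (Variables being
equivariant, each of its values is then finitely supported.) -/
def IsValuation (ε : ℕ → Set S.State) : Prop := FinSupp 𝒩 ε

/-- The transfinite iterates `f^0 = ∅`, `f^(o+1) = f (f^o)`, `f^l = ⋃_{o<l} f^o`. -/
noncomputable def iter {X : Type u} (f : Set X → Set X) (o : Ordinal.{u}) : Set X :=
  Ordinal.limitRecOn (motive := fun _ => Set X) o ∅ (fun _ T => f T)
    (fun l _ T => ⋃ (o' : Ordinal.{u}) (h : o' < l), T o' h)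

/-- `conv X A ε` is the least ordinal at which the iterates of `F_A^ε` reach the least fixpoint
of `F_A^ε` (among the finitely supported sets of states). -/
noncomputable def conv (X : ℕ) (A : PreFormula S) (ε : ℕ → Set S.State) : Ordinal.{u} :=
  sInf {o | IsLeast {T | FinSupp 𝒩 T ∧ step X A ε T = T} (iter (step X A ε) o)}

/-- The supremum of `conv X A ε` over the valuations `ε` in a set. -/
noncomputable def Conv (X : ℕ) (A : PreFormula S) (E : Set (ℕ → Set S.State)) : Ordinal.{u} :=
  sSup (conv X A '' E)

variable (S) in
/-- The least infinite cardinal larger than the number of states. -/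
noncomputable def nu : Cardinal.{u} := max (Order.succ #S.State) ℵ₀

/-! ## Substitution, unrolling, encoding

These functions are given through their graphs. A clause for `⟨α⟩A` applies to those
representatives of the formula whose binding names are fresh for the parameters. -/

/-- `Subst X C A B`: `B = A[C/X]`, by capture-avoiding substitution. -/
inductive Subst (X : ℕ) (C : PreFormula S) : PreFormula S → PreFormula S → Prop
  | conj {ι : Type u} {A B : ι → PreFormula S} :
      (∀ i, Subst X C (A i) (B i)) → Subst X C (conj A) (conj B)
  | neg {A B : PreFormula S} : Subst X C A B → Subst X C (neg A) (neg B)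
  | pred (φ : S.Pred) : Subst X C (pred φ) (pred φ)
  | dia {α : S.Act} {A B : PreFormula S} (hα : Fresh (S.bn α : Set 𝒩) C) :
      Subst X C A B → Subst X C (dia α A) (dia α B)
  | var_self : Subst X C (var X) C
  | var {Y : ℕ} (hY : Y ≠ X) : Subst X C (var Y) (var Y)
  | mu_self {A : PreFormula S} : Subst X C (mu X A) (mu X A)
  | mu {Y : ℕ} {A B : PreFormula S} (hY : Y ≠ X) (hC : ¬ FreeIn Y C) :
      Subst X C A B → Subst X C (mu Y A) (mu Y B)

/-- `Unroll X A o B`: `B` is the `o`-th unrolling of `μX.A`. -/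
inductive Unroll (X : ℕ) (A : PreFormula S) : Ordinal.{u} → PreFormula S → Prop
  | zero : Unroll X A 0 bot
  | succ {o : Ordinal.{u}} {B C : PreFormula S} :
      Unroll X A o B → Subst X B A C → Unroll X A (o + 1) C
  | limit {l : Ordinal.{u}} (hl : Order.IsSuccLimit l) {B : l.ToType → PreFormula S} :
      (∀ i, Unroll X A (Ordinal.ToType.toOrd i : Ordinal.{u}) (B i)) → Unroll X A l (disj B)

/-- The set `{ε[X ↦ (F_A^ε)^o] | ε ∈ E, o ≤ conv X A ε}` of valuations. -/
def extend (X : ℕ) (A : PreFormula S) (E : Set (ℕ → Set S.State)) :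
    Set (ℕ → Set S.State) :=
  {ε' | ∃ ε ∈ E, ∃ o ≤ conv X A ε, ε' = Function.update ε X (iter (step X A ε) o)}

/-- `Encodes E A B`: `B` is the fixpoint-free encoding of `A` with respect to the set `E` of
valuations. -/
inductive Encodes : Set (ℕ → Set S.State) → PreFormula S → PreFormula S → Prop
  | conj {E : Set (ℕ → Set S.State)} {ι : Type u} {A B : ι → PreFormula S} :
      (∀ i, Encodes E (A i) (B i)) → Encodes E (conj A) (conj B)
  | neg {E : Set (ℕ → Set S.State)} {A B : PreFormula S} :
      Encodes E A B → Encodes E (neg A) (neg B)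
  | pred {E : Set (ℕ → Set S.State)} (φ : S.Pred) : Encodes E (pred φ) (pred φ)
  | dia {E : Set (ℕ → Set S.State)} {α : S.Act} {A B : PreFormula S}
      (hα : Fresh (S.bn α : Set 𝒩) E) : Encodes E A B → Encodes E (dia α A) (dia α B)
  | var {E : Set (ℕ → Set S.State)} (X : ℕ) : Encodes E (var X) (var X)
  | mu {E : Set (ℕ → Set S.State)} {X : ℕ} {A B C : PreFormula S} :
      Encodes (extend X A E) A B → Unroll X B (Conv X B E) C → Encodes E (mu X A) C

end Formulas

end NomHML

open NomHML NomHML.PreFormula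

/-! The encoding is treated as an equivariant relation. One induction on formulas, with the set `E`
of valuations varying, shows that it is functional, yields fixpoint-free formulas, creates no new
signed free occurrences of variables, and preserves the interpretation on `E` (`exists_encoding`).
Two cases carry the weight.

Binders. As `E` is finitely supported, `⟨α⟩A` has a representative whose binding names are fresh for
`E`. Two such representatives differ by a permutation that moves only their binding names and hence
fixes `E`; equivariance together with uniqueness for the body then gives the same result for both
(`dia_eq_of_uniqueImage`). Semantically, a permutation `ρ` that fixes the set `E` may still move a
member `ε`, but `ρ⁻¹ • ε` is again in `E`. The induction hypothesis, which covers all members of `E`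
and all renamings of the body, therefore applies after transport by equivariance of the
interpretation (`interp_smul`).

Fixpoints. Positivity makes `F_A^ε` monotone on finitely supported sets. One finite set supports all
its iterates, so they stay among these sets; each non-stationary stage adds a state, so the
iteration stops at an ordinal of cardinality at most the number of states (`exists_iter_fixed`).
Since `ν` is regular, `E'` again has fewer than `ν` members (`mk_extend_lt`) and `γ < ν ≤ κ`
(`Conv_lt`), which keeps the disjunctions in the unrolling small enough. The set `E'` holds exactly
the valuations met while iterating `A`, so by induction the body and its encoding agree on them.
Their iterates coincide until that of `A` stabilises, and this common value is the least fixpoint of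
both (`iter_step_eq_of_agree`). The unrollings denote the iterates (`exists_unroll`), because
substitution corresponds to updating the valuation (`exists_subst`).

For closed formulas the valuation is irrelevant, and on closed fixpoint-free formulas validity is
membership in the interpretation. -/

namespace NomHML

/-! ## Finite permutations and supports -/

section Permutations

variable {𝒩 : Type u} [NameSpace 𝒩]

namespace NPerm

/-- The transposition of two names of the same sort. -/
noncomputable def swap (a b : 𝒩) (h : NameSpace.sort a = NameSpace.sort b) : NPerm 𝒩 := by
  classical
  exact ⟨Equiv.swap a b, (Set.toFinite {a, b}).subset fun c hc => by
      by_contra hn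
      simp only [Set.mem_insert_iff, Set.mem_singleton_iff, not_or] at hn
      exact hc (Equiv.swap_apply_of_ne_of_ne hn.1 hn.2), fun c => by
      rw [Equiv.swap_apply_def]
      split_ifs with h1 h2
      · rw [h1, h]
      · rw [h2, h]
      · rfl⟩

theorem sort_smul (π : NPerm 𝒩) (a : 𝒩) : NameSpace.sort (π • a) = NameSpace.sort a := π.2.2 a

theorem swap_left (a b : 𝒩) (h : NameSpace.sort a = NameSpace.sort b) : swap a b h • a = b := by
  classical exact Equiv.swap_apply_left a b

theorem swap_right (a b : 𝒩) (h : NameSpace.sort a = NameSpace.sort b) : swap a b h • b = a := by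
  classical exact Equiv.swap_apply_right a b

theorem swap_of_ne {a b c : 𝒩} (h : NameSpace.sort a = NameSpace.sort b) (h1 : c ≠ a)
    (h2 : c ≠ b) : swap a b h • c = c := by
  classical exact Equiv.swap_apply_of_ne_of_ne h1 h2

theorem swap_self (a : 𝒩) : swap a a rfl = 1 := by
  classical exact Subtype.ext (Equiv.swap_self a)

theorem swap_eq_mul {a b c : 𝒩} (hab : NameSpace.sort a = NameSpace.sort b)
    (hac : NameSpace.sort a = NameSpace.sort c) (hbc : NameSpace.sort b = NameSpace.sort c)
    (h1 : b ≠ c) (h2 : a ≠ b) :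
    swap a b hab = swap a c hac * swap b c hbc * swap a c hac := by
  classical
  apply Subtype.ext
  change Equiv.swap a b = Equiv.swap a c * Equiv.swap b c * Equiv.swap a c
  rw [Equiv.swap_comm a c, Equiv.swap_mul_swap_mul_swap h1 h2.symm]

/-- A permutation that fixes all names in `A` is a product of transpositions of names not
in `A`. -/
theorem mem_of_swap_mem {A : Set 𝒩} {H : Subgroup (NPerm 𝒩)}
    (hH : ∀ a b (h : NameSpace.sort a = NameSpace.sort b), a ∉ A → b ∉ A → swap a b h ∈ H)
    {π : NPerm 𝒩} (hπ : ∀ a ∈ A, π • a = a) : π ∈ H := by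
  -- Induction on the number of moved names: following `π` by the transposition of `a` and `π • a`
  -- makes `a` fixed and keeps every name fixed by `π` fixed.
  obtain ⟨n, hn⟩ : ∃ n, {a : 𝒩 | π • a ≠ a}.ncard = n := ⟨_, rfl⟩
  induction n using Nat.strong_induction_on generalizing π with
  | _ n ih =>
  have hfin : {a : 𝒩 | π • a ≠ a}.Finite := π.2.1
  by_cases he : ∃ a : 𝒩, π • a ≠ a
  · obtain ⟨a, ha⟩ := he
    have hs : NameSpace.sort a = NameSpace.sort (π • a) := (sort_smul π a).symm
    have haA : a ∉ A := fun h => ha (hπ a h)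
    have hbA : π • a ∉ A := fun h => ha (smul_left_cancel π (hπ _ h))
    have hsw := hH a (π • a) hs haA hbA
    have hfix : ∀ c : 𝒩, π • c = c → (swap a (π • a) hs * π) • c = c := by
      intro c hc
      rw [mul_smul, hc]
      refine swap_of_ne hs ?_ ?_
      · rintro rfl; exact ha hc
      · intro h
        rw [← hc] at h
        have := smul_left_cancel π h
        subst this
        exact ha hc
    have key : swap a (π • a) hs * π ∈ H := by
      refine ih _ ?_ (fun c hc => hfix c (hπ c hc)) rfl
      rw [← hn]
      refine Set.ncard_lt_ncard ⟨fun c hc h => hc (hfix c h), fun h => ?_⟩ hfin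
      refine h (show a ∈ _ from ha) ?_
      rw [mul_smul, swap_right]
    have := H.mul_mem (H.inv_mem hsw) key
    rwa [inv_mul_cancel_left] at this
  · push Not at he
    have : π = 1 := Subtype.ext (Equiv.ext he)
    rw [this]
    exact H.one_mem

/-- Fresh names of every sort. -/
theorem exists_fresh (a : 𝒩) (Z : Finset 𝒩) : ∃ c, NameSpace.sort c = NameSpace.sort a ∧ c ∉ Z := by
  obtain ⟨c, hc, hcZ⟩ := (NameSpace.infinite_sort a).exists_notMem_finset Z
  exact ⟨c, hc, hcZ⟩

/-- A permutation can be changed outside a finite set `N` so that it moves names in `N` and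
its image only. -/
theorem exists_restrict (N : Finset 𝒩) (ρ : NPerm 𝒩) :
    ∃ π : NPerm 𝒩, (∀ a ∈ N, π • a = ρ • a) ∧
      ∀ a, π • a ≠ a → a ∈ N ∨ ∃ b ∈ N, ρ • b = a := by
  classical
  induction N using Finset.induction_on with
  | empty => exact ⟨1, by simp, by simp⟩
  | insert a N ha ih =>
    obtain ⟨π, h1, h2⟩ := ih
    have hs : NameSpace.sort (π • a) = NameSpace.sort (ρ • a) := by simp only [sort_smul]
    -- The transposition corrects the value at `a`. It leaves the values on `N` alone, since there
    -- `π` and `ρ` agree and are injective.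
    refine ⟨swap (π • a) (ρ • a) hs * π, fun c hc => ?_, fun c hc => ?_⟩
    · rw [mul_smul]
      rcases Finset.mem_insert.1 hc with rfl | hc
      · exact swap_left _ _ hs
      · have hca : c ≠ a := fun h => ha (h ▸ hc)
        rw [swap_of_ne hs (fun h => hca (smul_left_cancel π h)), h1 c hc]
        rw [h1 c hc]
        exact fun h => hca (smul_left_cancel ρ h)
    · by_cases hπ : π • c = c
      · rw [mul_smul, hπ] at hc
        by_cases e1 : c = π • a
        · rw [e1] at hπ
          have := smul_left_cancel π hπ
          exact Or.inl (Finset.mem_insert.2 (Or.inl (e1.trans this)))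
        · by_cases e2 : c = ρ • a
          · exact Or.inr ⟨a, Finset.mem_insert_self _ _, e2.symm⟩
          · exact absurd (swap_of_ne hs e1 e2) hc
      · rcases h2 c hπ with h | ⟨b, hb, h⟩
        · exact Or.inl (Finset.mem_insert_of_mem h)
        · exact Or.inr ⟨b, Finset.mem_insert_of_mem hb, h⟩

/-- The names in `N` can be renamed into names outside `Z`. -/
theorem exists_rename (N Z : Finset 𝒩) :
    ∃ π : NPerm 𝒩, (∀ a ∈ N, π • a ∉ Z) ∧ ∀ a, π • a ≠ a → a ∈ N ∨ ∃ b ∈ N, π • b = a := by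
  classical
  -- Any permutation taking `N` outside `Z` will do: `exists_restrict` discards its superfluous
  -- moves.
  suffices h : ∃ π : NPerm 𝒩, ∀ a ∈ N, π • a ∉ Z by
    obtain ⟨ρ, hρ⟩ := h
    obtain ⟨π, h1, h2⟩ := exists_restrict N ρ
    refine ⟨π, fun a ha => by rw [h1 a ha]; exact hρ a ha, fun a ha => ?_⟩
    rcases h2 a ha with h | ⟨b, hb, h⟩
    · exact Or.inl h
    · exact Or.inr ⟨b, hb, by rw [h1 b hb, h]⟩
  induction N using Finset.induction_on with
  | empty => exact ⟨1, by simp⟩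
  | insert a N ha ih =>
    obtain ⟨π, hπ⟩ := ih
    -- Avoiding the image of `N` as well ensures that the new transposition does not disturb the
    -- names already renamed.
    obtain ⟨c, hc, hcZ⟩ := exists_fresh (π • a) (Z ∪ N.image (π • ·))
    rw [Finset.mem_union, not_or] at hcZ
    refine ⟨swap (π • a) c hc.symm * π, fun b hb => ?_⟩
    rw [mul_smul]
    rcases Finset.mem_insert.1 hb with rfl | hb
    · rw [swap_left]
      exact hcZ.1
    · rw [swap_of_ne]
      · exact hπ b hb
      · intro h
        have := smul_left_cancel π h
        exact ha (this ▸ hb)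
      · rintro rfl
        exact hcZ.2 (Finset.mem_image_of_mem _ hb)

end NPerm
end Permutations

/-! ### Least supports and freshness. -/

section Supports

variable {𝒩 : Type u} [NameSpace 𝒩] {X : Type*} [MulAction (NPerm 𝒩) X]

open MulAction in
theorem notMem_supp_iff {a : 𝒩} {x : X} :
    a ∉ supp 𝒩 x ↔ ∃ N : Finset 𝒩, Supports (NPerm 𝒩) (N : Set 𝒩) x ∧ a ∉ N := by
  simp [supp]

theorem supp_subset {x : X} {N : Finset 𝒩}
    (h : MulAction.Supports (NPerm 𝒩) (N : Set 𝒩) x) : supp 𝒩 x ⊆ N := fun _ ha => ha N h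

/-- The finite supports omitting `a` and omitting `b` may be different sets. With `c` outside both,
the transpositions of `a, c` and of `b, c` each fix one of these supports pointwise, and the
transposition of `a, b` is a product of them. -/
theorem FinSupp.swap_smul {x : X} {a b : 𝒩} (h : NameSpace.sort a = NameSpace.sort b)
    (ha : a ∉ supp 𝒩 x) (hb : b ∉ supp 𝒩 x) : NPerm.swap a b h • x = x := by
  classical
  obtain ⟨N, hN, haN⟩ := notMem_supp_iff.1 ha
  obtain ⟨M, hM, hbM⟩ := notMem_supp_iff.1 hb
  by_cases hab : a = b
  · subst hab
    rw [NPerm.swap_self, one_smul]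
  obtain ⟨c, hc, hcZ⟩ := NPerm.exists_fresh a (N ∪ M ∪ {b})
  simp only [Finset.mem_union, Finset.mem_singleton, not_or] at hcZ
  have e1 : NPerm.swap a c hc.symm • x = x := hN _ fun d hd =>
    NPerm.swap_of_ne _ (fun e => haN (e ▸ hd)) (fun e => hcZ.1.1 (e ▸ hd))
  have e2 : NPerm.swap b c (h.symm.trans hc.symm) • x = x := hM _ fun d hd =>
    NPerm.swap_of_ne _ (fun e => hbM (e ▸ hd)) (fun e => hcZ.1.2 (e ▸ hd))
  rw [NPerm.swap_eq_mul h hc.symm (h.symm.trans hc.symm) (Ne.symm hcZ.2) hab, mul_smul, mul_smul,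
    e1, e2, e1]

/-- The support of an object supports it. -/
theorem smul_eq_of_fix_supp {x : X} {π : NPerm 𝒩}
    (h : ∀ a ∈ supp 𝒩 x, π • a = a) : π • x = x :=
  NPerm.mem_of_swap_mem (H := MulAction.stabilizer (NPerm 𝒩) x)
    (fun _ _ h ha hb => FinSupp.swap_smul h ha hb) h

theorem FinSupp.smul {x : X} (h : FinSupp 𝒩 x) (π : NPerm 𝒩) : FinSupp 𝒩 (π • x) := by
  obtain ⟨N, hN⟩ := h
  exact ⟨_, supports_smul π hN⟩

theorem Supports.mono_finset {x : X} {N M : Finset 𝒩} (h : N ⊆ M)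
    (hN : MulAction.Supports (NPerm 𝒩) (N : Set 𝒩) x) :
    MulAction.Supports (NPerm 𝒩) (M : Set 𝒩) x := fun _ hg => hN _ fun _ ha => hg (h ha)

theorem Fresh.smul {N M : Set 𝒩} {x : X} (h : Fresh N x) {π : NPerm 𝒩} (hM : M = π • N) :
    Fresh M (π • x) := by
  intro a ha hax
  rw [hM, Set.mem_smul_set_iff_inv_smul_mem] at ha
  exact h _ ha (mem_supp_of_smul hax)

theorem Fresh.of_supports {N : Set 𝒩} {M : Finset 𝒩} {x : X}
    (h : MulAction.Supports (NPerm 𝒩) (M : Set 𝒩) x) (hd : ∀ a ∈ N, a ∉ M) : Fresh N x :=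
  fun a ha hax => hd a ha (supp_subset h hax)

/-- A permutation that moves only names in `N ∪ M` fixes the objects for which `N` and `M` are
fresh. -/
theorem Fresh.smul_eq {N M : Set 𝒩} {x : X} (hN : Fresh N x) (hM : Fresh M x) {π : NPerm 𝒩}
    (h : ∀ a : 𝒩, π • a ≠ a → a ∈ N ∨ a ∈ M) : π • x = x := by
  refine smul_eq_of_fix_supp fun a ha => ?_
  by_contra hne
  rcases h a hne with h | h
  · exact hN a h ha
  · exact hM a h ha

end Supports

end NomHML

namespace NomHML

/-! ## The structure of formulas -/

section Structure

variable {𝒩 : Type u} [NameSpace 𝒩] {S : NTS 𝒩}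

theorem smul_mem_bn {π : NPerm 𝒩} {α : S.Act} {a : 𝒩} :
    a ∈ S.bn (π • α) ↔ ∃ b ∈ S.bn α, π • b = a := by
  rw [← Finset.mem_coe, S.bn_smul]
  exact Iff.rfl

namespace Raw

theorem smul_conj (π : NPerm 𝒩) {ι : Type u} (R : ι → Raw S) :
    π • conj ι R = conj ι fun i => π • R i := rfl

/-- The outermost constructor of a raw formula. -/
def head : Raw S → ℕ
  | conj _ _ => 0
  | neg _ => 1
  | pred _ => 2
  | dia _ _ => 3
  | var _ => 4
  | mu _ _ => 5

end Raw

namespace PreFormula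

/-- The class of a raw formula. -/
def mk (R : Raw S) : PreFormula S := Quotient.mk (Raw.setoid S) R

@[elab_as_elim] theorem mk_ind {motive : PreFormula S → Prop} (h : ∀ R, motive (mk R))
    (A : PreFormula S) : motive A := Quotient.inductionOn A h

theorem mk_eq_mk {R R' : Raw S} :
    mk R = mk R' ↔ Raw.Alpha R R' :=
  ⟨fun h => Quotient.exact h, fun h => Quotient.sound h⟩

theorem smul_mk (π : NPerm 𝒩) (R : Raw S) :
    π • mk R = mk (π • R) := rfl

theorem mk_out (A : PreFormula S) : mk (Quotient.out A) = A :=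
  Quotient.out_eq A

theorem mk_conj {ι : Type u} (R : ι → Raw S) :
    mk (Raw.conj ι R) =
      conj fun i => mk (R i) :=
  mk_eq_mk.2 <| .conj id id (fun _ => mk_eq_mk.1 (mk_out _).symm)
    (fun _ => mk_eq_mk.1 (mk_out _).symm)

theorem mk_neg (R : Raw S) : mk (Raw.neg R) =
    neg (mk R) := rfl
theorem mk_dia (α : S.Act) (R : Raw S) :
    mk (Raw.dia α R) =
      dia α (mk R) := rfl
theorem mk_mu (X : ℕ) (R : Raw S) : mk (Raw.mu X R) =
    mu X (mk R) := rfl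

theorem smul_conj (π : NPerm 𝒩) {ι : Type u} (A : ι → PreFormula S) :
    π • conj A = conj fun i => π • A i := by
  have h : conj A = mk (Raw.conj ι fun i => (A i).out) := rfl
  rw [h, smul_mk, Raw.smul_conj, mk_conj]
  simp only [← smul_mk, mk_out]

theorem smul_neg (π : NPerm 𝒩) (A : PreFormula S) : π • neg A = neg (π • A) := by
  induction A using mk_ind with | _ R => rfl
theorem smul_pred (π : NPerm 𝒩) (φ : S.Pred) : π • (pred φ : PreFormula S) = pred (π • φ) := rfl
theorem smul_dia (π : NPerm 𝒩) (α : S.Act) (A : PreFormula S) :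
    π • dia α A = dia (π • α) (π • A) := by
  induction A using mk_ind with | _ R => rfl
theorem smul_var (π : NPerm 𝒩) (X : ℕ) : π • (var X : PreFormula S) = var X := rfl
theorem smul_mu (π : NPerm 𝒩) (X : ℕ) (A : PreFormula S) : π • mu X A = mu X (π • A) := by
  induction A using mk_ind with | _ R => rfl

theorem smul_bot (π : NPerm 𝒩) : π • (bot : PreFormula S) = bot := by
  rw [bot, smul_neg, smul_conj]
  congr 2
  funext i
  exact i.elim

theorem smul_disj (π : NPerm 𝒩) {ι : Type u} (A : ι → PreFormula S) :
    π • disj A = disj fun i => π • A i := by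
  simp only [disj, smul_neg, smul_conj]

/-- The outermost constructor of a formula. -/
def head : PreFormula S → ℕ :=
  Quotient.lift Raw.head fun _ _ h => by cases h <;> rfl

@[simp] theorem head_conj {ι : Type u} (A : ι → PreFormula S) : head (conj A) = 0 := rfl
@[simp] theorem head_neg (A : PreFormula S) : head (neg A) = 1 := by
  induction A using mk_ind with | _ R => rfl
@[simp] theorem head_pred (φ : S.Pred) : head (pred φ : PreFormula S) = 2 := rfl
@[simp] theorem head_dia (α : S.Act) (A : PreFormula S) : head (dia α A) = 3 := by
  induction A using mk_ind with | _ R => rfl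
@[simp] theorem head_var (X : ℕ) : head (var X : PreFormula S) = 4 := rfl
@[simp] theorem head_mu (X : ℕ) (A : PreFormula S) : head (mu X A) = 5 := by
  induction A using mk_ind with | _ R => rfl

theorem conj_eq_iff {ι κ : Type u} {A : ι → PreFormula S} {B : κ → PreFormula S} :
    conj A = conj B ↔ Set.range A = Set.range B := by
  constructor
  · intro h
    have h := mk_eq_mk.1 h
    cases h with
    | conj f g hf hg =>
      apply Set.Subset.antisymm
      · rintro _ ⟨i, rfl⟩
        exact ⟨f i, by rw [← mk_out (A i), ← mk_out (B (f i))]; exact (mk_eq_mk.2 (hf i)).symm⟩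
      · rintro _ ⟨j, rfl⟩
        exact ⟨g j, by rw [← mk_out (A (g j)), ← mk_out (B j)]; exact (mk_eq_mk.2 (hg j))⟩
  · intro h
    have h1 : ∀ i, ∃ j, B j = A i := fun i => by
      have : A i ∈ Set.range B := h ▸ Set.mem_range_self i
      exact this
    have h2 : ∀ j, ∃ i, A i = B j := fun j => by
      have : B j ∈ Set.range A := h ▸ Set.mem_range_self j
      exact this
    choose f hf using h1
    choose g hg using h2
    exact mk_eq_mk.2 (.conj f g (fun i => by rw [hf]; exact .refl _)
      (fun j => by rw [hg]; exact .refl _))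

theorem neg_injective : Function.Injective (neg : PreFormula S → PreFormula S) := by
  intro A B h
  induction A using mk_ind with | _ R =>
  induction B using mk_ind with | _ R' =>
  have h := mk_eq_mk.1 h
  cases h with
  | neg h => exact mk_eq_mk.2 h

theorem var_injective : Function.Injective (var : ℕ → PreFormula S) := by
  intro φ ψ h
  have h := mk_eq_mk.1 h
  cases h
  rfl

theorem mu_inj {X Y : ℕ} {A B : PreFormula S} (h : mu X A = mu Y B) : X = Y ∧ A = B := by
  induction A using mk_ind with | _ R =>
  induction B using mk_ind with | _ R' =>
  have h := mk_eq_mk.1 h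
  cases h with
  | mu _ h => exact ⟨rfl, mk_eq_mk.2 h⟩

/-- The sets `N a` in `Alpha.dia` are precisely witnesses that `a` is outside the support of the
class, so the raw side condition becomes one about `supp`. -/
theorem dia_eq_iff {α β : S.Act} {A B : PreFormula S} :
    dia α A = dia β B ↔ ∃ π : NPerm 𝒩, π • α = β ∧ π • A = B ∧
      ∀ a ∉ S.bn α, π • a ≠ a → a ∉ supp 𝒩 α ∧ a ∉ supp 𝒩 A := by
  induction A using mk_ind with | _ R =>
  induction B using mk_ind with | _ R' =>
  rw [← mk_dia, ← mk_dia, mk_eq_mk]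
  constructor
  · intro h
    cases h with
    | dia π N hα hR hN hfix =>
      refine ⟨π, hα, mk_eq_mk.2 hR, fun a ha hne => ⟨(hfix a ha hne).1, ?_⟩⟩
      exact notMem_supp_iff.2 ⟨N a, fun σ hσ => mk_eq_mk.2 (hN a ha hne σ fun b hb => hσ hb),
        (hfix a ha hne).2⟩
  · rintro ⟨π, hα, hR, hfix⟩
    classical
    -- The value `∅` at names in the support is arbitrary: `Alpha.dia` constrains `N a` only at
    -- names that `hfix` puts outside the support.
    have h : ∀ a, ∃ N : Finset 𝒩, a ∉ supp 𝒩 (mk R) →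
        MulAction.Supports (NPerm 𝒩) (N : Set 𝒩)
          (mk R) ∧ a ∉ N := by
      intro a
      by_cases ha : a ∈ supp 𝒩 (mk R)
      · exact ⟨∅, fun h => absurd ha h⟩
      · obtain ⟨N, hN⟩ := notMem_supp_iff.1 ha
        exact ⟨N, fun _ => hN⟩
    choose N hN using h
    refine .dia π N hα (mk_eq_mk.1 hR) (fun a ha hne σ hσ => ?_) (fun a ha hne => ?_)
    · exact mk_eq_mk.1 ((hN a (hfix a ha hne).2).1 σ fun b hb => hσ b hb)
    · exact ⟨(hfix a ha hne).1, (hN a (hfix a ha hne).2).2⟩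

theorem dia_smul {α : S.Act} {A : PreFormula S} {π : NPerm 𝒩}
    (h : ∀ a ∉ S.bn α, π • a ≠ a → a ∉ supp 𝒩 α ∧ a ∉ supp 𝒩 A) :
    dia (π • α) (π • A) = dia α A :=
  (dia_eq_iff.2 ⟨π, rfl, rfl, h⟩).symm

/-- Representatives of the same formula differ by a permutation that moves only names that
are bound in one of them. -/
theorem exists_smul_of_dia_eq {α β : S.Act} {A B : PreFormula S} (h : dia α A = dia β B) :
    ∃ π : NPerm 𝒩, π • α = β ∧ π • A = B ∧
      (∀ a, π • a ≠ a → a ∈ S.bn α ∨ a ∈ S.bn β) ∧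
      ∀ a ∉ S.bn α, a ∈ S.bn β → a ∉ supp 𝒩 α ∧ a ∉ supp 𝒩 A := by
  obtain ⟨ρ, rfl, rfl, hρ⟩ := dia_eq_iff.1 h
  obtain ⟨π, h1, h2⟩ := NPerm.exists_restrict (S.bn α) ρ
  -- A binding name of `ρ • α` that is not one of `α` must be moved by `ρ`, because it is the image
  -- of a different name; so `hρ` applies to it.
  have h3 : ∀ a ∉ S.bn α, a ∈ S.bn (ρ • α) → a ∉ supp 𝒩 α ∧ a ∉ supp 𝒩 A := by
    intro a ha hb
    refine hρ a ha fun he => ?_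
    obtain ⟨b, hb, hba⟩ := smul_mem_bn.1 hb
    rw [← he] at hba
    exact ha (smul_left_cancel ρ hba ▸ hb)
  have h2' : ∀ a, π • a ≠ a → a ∈ S.bn α ∨ a ∈ S.bn (ρ • α) := fun a ha =>
    (h2 a ha).imp id smul_mem_bn.2
  -- On the supports of `α` and `A` the restricted permutation agrees with `ρ`, so it acts on both
  -- in the same way.
  have h4 : ∀ a, a ∈ supp 𝒩 α ∨ a ∈ supp 𝒩 A → π • a = ρ • a := by
    intro a ha
    by_cases hb : a ∈ S.bn α
    · exact h1 a hb
    · have e1 : ρ • a = a := by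
        by_contra hne
        have := hρ a hb hne
        tauto
      have e2 : π • a = a := by
        by_contra hne
        have := h3 a hb ((h2' a hne).resolve_left hb)
        tauto
      rw [e1, e2]
  have h5 : ∀ a, a ∈ supp 𝒩 α ∨ a ∈ supp 𝒩 A → (ρ⁻¹ * π) • a = a := fun a ha => by
    rw [mul_smul, h4 a ha, inv_smul_smul]
  refine ⟨π, ?_, ?_, h2', h3⟩
  · have : (ρ⁻¹ * π) • α = α := smul_eq_of_fix_supp fun a ha => h5 a (Or.inl ha)
    rwa [mul_smul, inv_smul_eq_iff] at this
  · have : (ρ⁻¹ * π) • A = A := smul_eq_of_fix_supp fun a ha => h5 a (Or.inr ha)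
    rwa [mul_smul, inv_smul_eq_iff] at this

/-- A representative of `⟨α⟩A` whose binding names avoid a given finite set. -/
theorem exists_fresh_dia (α : S.Act) {A : PreFormula S} (hA : FinSupp 𝒩 A) (Z : Finset 𝒩) :
    ∃ π : NPerm 𝒩, dia (π • α) (π • A) = dia α A ∧ (∀ a ∈ S.bn (π • α), a ∉ Z) := by
  classical
  obtain ⟨N, hN⟩ := NominalSet.finSupp (𝒩 := 𝒩) α
  obtain ⟨M, hM⟩ := hA
  obtain ⟨π, h1, h2⟩ := NPerm.exists_rename (S.bn α) (Z ∪ N ∪ M)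
  simp only [Finset.mem_union, not_or] at h1
  refine ⟨π, dia_smul fun a ha hne => ?_, fun a ha => ?_⟩
  · obtain ⟨b, hb, rfl⟩ := (h2 a hne).resolve_left ha
    exact ⟨fun h => (h1 b hb).1.2 (supp_subset hN h), fun h => (h1 b hb).2 (supp_subset hM h)⟩
  · obtain ⟨b, hb, rfl⟩ := smul_mem_bn.1 ha
    exact (h1 b hb).1.1

/-- Structural induction; in the clause for `⟨α⟩A` the induction hypothesis is available for all
renamings of `A`. -/
theorem induction_perm {motive : PreFormula S → Prop}
    (conj : ∀ {ι : Type u} (A : ι → PreFormula S), (∀ i, motive (A i)) → motive (conj A))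
    (neg : ∀ A, motive A → motive (neg A)) (pred : ∀ φ, motive (pred φ))
    (dia : ∀ α A, (∀ π : NPerm 𝒩, motive (π • A)) → motive (dia α A))
    (var : ∀ X, motive (var X)) (mu : ∀ X A, motive A → motive (mu X A))
    (A : PreFormula S) : motive A := by
  induction A using mk_ind with | _ R =>
  suffices h : ∀ π : NPerm 𝒩, motive (π • mk R) by
    simpa only [one_smul] using h 1
  induction R with
  | conj ι R ih => intro π; rw [mk_conj, smul_conj]; exact conj _ fun i => ih i π
  | neg R ih => intro π; rw [mk_neg, smul_neg]; exact neg _ (ih π)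
  | pred φ => intro π; exact pred _
  | dia α R ih =>
    intro π
    rw [mk_dia, smul_dia]
    exact dia _ _ fun ρ => by rw [← mul_smul]; exact ih _
  | var X => intro π; exact var _
  | mu X R ih => intro π; rw [mk_mu, smul_mu]; exact mu _ _ (ih π)

theorem finSupp_range_smul {ι : Type*} {X : Type*} [MulAction (NPerm 𝒩) X] {A : ι → X}
    (h : FinSupp 𝒩 (Set.range A)) (π : NPerm 𝒩) : FinSupp 𝒩 (Set.range fun i => π • A i) := by
  have : (Set.range fun i => π • A i) = π • Set.range A := by
    rw [← Set.image_smul, ← Set.range_comp]; rfl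
  rw [this]
  exact h.smul π

/-! ### Free occurrences and inversion principles. -/

theorem Occurs.smul {X : ℕ} {b : Bool} {A : PreFormula S} (h : Occurs X b A) (π : NPerm 𝒩) :
    Occurs X b (π • A) := by
  induction h with
  | conj i _ ih => rw [smul_conj]; exact .conj i ih
  | neg _ ih => rw [smul_neg]; exact .neg ih
  | dia _ ih => rw [smul_dia]; exact .dia ih
  | var => exact .var
  | mu hY _ ih => rw [smul_mu]; exact .mu hY ih

theorem occurs_smul_iff {X : ℕ} {b : Bool} {A : PreFormula S} {π : NPerm 𝒩} :
    Occurs X b (π • A) ↔ Occurs X b A :=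
  ⟨fun h => by simpa only [inv_smul_smul] using h.smul π⁻¹, fun h => h.smul π⟩

/-- The formula constructors are functions into a quotient, so case analysis cannot unify their
images directly. Here and in the similar inversions below, the formula is generalised, `head`
excludes the wrong constructors, and the equality criterion of the right one, where needed, handles
the remaining case. -/
theorem occurs_conj_iff {X : ℕ} {b : Bool} {ι : Type u} {A : ι → PreFormula S} :
    Occurs X b (conj A) ↔ ∃ i, Occurs X b (A i) := by
  refine ⟨fun h => ?_, fun ⟨i, h⟩ => .conj i h⟩
  generalize hD : conj A = D at h
  cases h with
  | @conj _ B _ i h =>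
    obtain ⟨j, hj⟩ : B i ∈ Set.range A := conj_eq_iff.1 hD ▸ Set.mem_range_self i
    exact ⟨j, hj ▸ h⟩
  | _ => exact absurd (congrArg head hD) (by simp)

theorem occurs_neg_iff {X : ℕ} {b : Bool} {A : PreFormula S} :
    Occurs X b (neg A) ↔ Occurs X (!b) A := by
  refine ⟨fun h => ?_, fun h => by simpa using Occurs.neg h⟩
  generalize hD : neg A = D at h
  cases h with
  | neg h => rwa [neg_injective hD, Bool.not_not]
  | _ => exact absurd (congrArg head hD) (by simp)

theorem not_occurs_pred {X : ℕ} {b : Bool} {φ : S.Pred} : ¬ Occurs X b (pred φ) := by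
  intro h
  generalize hD : (pred φ : PreFormula S) = D at h
  cases h with
  | _ => exact absurd (congrArg head hD) (by simp)

theorem occurs_dia_iff {X : ℕ} {b : Bool} {α : S.Act} {A : PreFormula S} :
    Occurs X b (dia α A) ↔ Occurs X b A := by
  refine ⟨fun h => ?_, fun h => .dia h⟩
  generalize hD : dia α A = D at h
  cases h with
  | dia h =>
    obtain ⟨π, -, rfl, -⟩ := dia_eq_iff.1 hD
    exact occurs_smul_iff.1 h
  | _ => exact absurd (congrArg head hD) (by simp)

theorem occurs_var_iff {X Y : ℕ} {b : Bool} :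
    Occurs X b (var Y : PreFormula S) ↔ Y = X ∧ b = true := by
  refine ⟨fun h => ?_, fun ⟨h1, h2⟩ => by subst h1 h2; exact .var⟩
  generalize hD : (var Y : PreFormula S) = D at h
  cases h with
  | var => exact ⟨var_injective hD, rfl⟩
  | _ => exact absurd (congrArg head hD) (by simp)

/-- Induction on formulas; in the clause for `⟨α⟩A` the induction hypothesis is available for all
renamings of `A`. -/
theorem isFormula_induction {κ : Cardinal.{u}} {motive : ∀ A : PreFormula S, IsFormula κ A → Prop}
    (conj : ∀ {ι : Type u} (A : ι → PreFormula S) (hι : #ι < κ) (hfs : FinSupp 𝒩 (Set.range A))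
      (hA : ∀ i, IsFormula κ (A i)), (∀ i, motive (A i) (hA i)) → motive _ (.conj hι hfs hA))
    (neg : ∀ A (hA : IsFormula κ A), motive A hA → motive _ (.neg hA))
    (pred : ∀ φ, motive _ (.pred φ))
    (dia : ∀ α A (hA : IsFormula κ A) (hA' : ∀ π : NPerm 𝒩, IsFormula κ (π • A)),
      (∀ π : NPerm 𝒩, motive (π • A) (hA' π)) → motive _ (.dia α hA))
    (var : ∀ X, motive _ (.var X))
    (mu : ∀ X A (hpos : ¬ Occurs X false A) (hA : IsFormula κ A), motive A hA →
      motive _ (.mu X hpos hA))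
    {A : PreFormula S} (hA : IsFormula κ A) : motive A hA := by
  -- The motive depends on the formula and on the proof that it is one, so rewriting a permuted
  -- formula needs explicit transport.
  have cast : ∀ {B C : PreFormula S} (_ : B = C) {hB : IsFormula κ B} {hC : IsFormula κ C},
      motive B hB → motive C hC := by
    rintro B _ rfl _ _ h
    exact h
  suffices h : ∀ π : NPerm 𝒩, ∃ h : IsFormula κ (π • A), motive (π • A) h by
    exact cast (one_smul _ A) (h 1).2
  induction hA with
  | @conj ι A hι hfs hA ih =>
    intro π
    have := conj (fun i => π • A i) hι (finSupp_range_smul hfs π) (fun i => (ih i π).1)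
      fun i => (ih i π).2
    rw [smul_conj]
    exact ⟨_, this⟩
  | neg _ ih => intro π; rw [smul_neg]; exact ⟨_, neg _ _ (ih π).2⟩
  | pred φ => intro π; exact ⟨_, pred _⟩
  | dia α _ ih =>
    intro π
    rw [smul_dia]
    exact ⟨_, dia _ _ (ih π).1 (fun ρ => by rw [← mul_smul]; exact (ih _).1) fun ρ =>
      cast (mul_smul ρ π _) (ih (ρ * π)).2⟩
  | var X => intro π; exact ⟨_, var _⟩
  | mu X hpos _ ih =>
    intro π
    rw [smul_mu]
    exact ⟨_, mu _ _ (fun h => hpos (occurs_smul_iff.1 h)) _ (ih π).2⟩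

theorem FixFree.smul {A : PreFormula S} (h : FixFree A) (π : NPerm 𝒩) : FixFree (π • A) := by
  induction h with
  | conj _ ih => rw [smul_conj]; exact .conj ih
  | neg _ ih => rw [smul_neg]; exact .neg ih
  | pred φ => exact .pred _
  | dia α _ ih => rw [smul_dia]; exact .dia _ ih
  | var X => exact .var X

theorem fixFree_smul_iff {A : PreFormula S} {π : NPerm 𝒩} : FixFree (π • A) ↔ FixFree A :=
  ⟨fun h => by simpa only [inv_smul_smul] using h.smul π⁻¹, fun h => h.smul π⟩

theorem fixFree_conj_iff {ι : Type u} {A : ι → PreFormula S} :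
    FixFree (conj A) ↔ ∀ i, FixFree (A i) := by
  refine ⟨fun h => ?_, .conj⟩
  generalize hD : conj A = D at h
  cases h with
  | @conj _ B h =>
    intro i
    obtain ⟨j, hj⟩ : A i ∈ Set.range B := conj_eq_iff.1 hD ▸ Set.mem_range_self i
    exact hj ▸ h j
  | _ => exact absurd (congrArg head hD) (by simp)

theorem fixFree_neg_iff {A : PreFormula S} : FixFree (neg A) ↔ FixFree A := by
  refine ⟨fun h => ?_, .neg⟩
  generalize hD : neg A = D at h
  cases h with
  | neg h => rwa [neg_injective hD]
  | _ => exact absurd (congrArg head hD) (by simp)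

theorem fixFree_dia_iff {α : S.Act} {A : PreFormula S} : FixFree (dia α A) ↔ FixFree A := by
  refine ⟨fun h => ?_, .dia α⟩
  generalize hD : dia α A = D at h
  cases h with
  | dia β h =>
    obtain ⟨π, -, rfl, -⟩ := dia_eq_iff.1 hD
    exact fixFree_smul_iff.1 h
  | _ => exact absurd (congrArg head hD) (by simp)

theorem not_fixFree_mu {X : ℕ} {A : PreFormula S} : ¬ FixFree (mu X A) := by
  intro h
  generalize hD : mu X A = D at h
  cases h with
  | _ => exact absurd (congrArg head hD) (by simp)

/-! ### Formulas are finitely supported. -/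

theorem supports_neg {N : Set 𝒩} {A : PreFormula S} (h : MulAction.Supports (NPerm 𝒩) N A) :
    MulAction.Supports (NPerm 𝒩) N (neg A) := fun π hπ => by rw [smul_neg, h π hπ]

theorem supports_mu {N : Set 𝒩} {X : ℕ} {A : PreFormula S}
    (h : MulAction.Supports (NPerm 𝒩) N A) : MulAction.Supports (NPerm 𝒩) N (mu X A) :=
  fun π hπ => by rw [smul_mu, h π hπ]

theorem supports_conj {N : Set 𝒩} {ι : Type u} {A : ι → PreFormula S}
    (h : MulAction.Supports (NPerm 𝒩) N (Set.range A)) :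
    MulAction.Supports (NPerm 𝒩) N (conj A) := fun π hπ => by
  rw [smul_conj, conj_eq_iff]
  conv_rhs => rw [← h π hπ, ← Set.image_smul, ← Set.range_comp]
  rfl

theorem supports_dia {N M : Finset 𝒩} {α : S.Act} {A : PreFormula S}
    (hα : MulAction.Supports (NPerm 𝒩) (N : Set 𝒩) α)
    (hA : MulAction.Supports (NPerm 𝒩) (M : Set 𝒩) A) [DecidableEq 𝒩] :
    MulAction.Supports (NPerm 𝒩) ((N ∪ M : Finset 𝒩) : Set 𝒩) (dia α A) := fun π hπ => by
  rw [smul_dia, Supports.mono_finset Finset.subset_union_left hα π hπ,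
    Supports.mono_finset Finset.subset_union_right hA π hπ]

theorem IsFormula.finSupp {κ : Cardinal.{u}} {A : PreFormula S} (h : IsFormula κ A) :
    FinSupp 𝒩 A := by
  classical
  induction h with
  | conj _ hfs _ _ => exact hfs.imp fun N => supports_conj
  | neg _ ih => exact ih.imp fun N => supports_neg
  | pred φ =>
    obtain ⟨N, hN⟩ := NominalSet.finSupp (𝒩 := 𝒩) φ
    exact ⟨N, fun π hπ => by rw [smul_pred, hN π hπ]⟩
  | dia α _ ih =>
    obtain ⟨N, hN⟩ := NominalSet.finSupp (𝒩 := 𝒩) α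
    obtain ⟨M, hM⟩ := ih
    exact ⟨_, supports_dia hN hM⟩
  | var X => exact ⟨∅, fun π _ => smul_var π X⟩
  | mu X _ _ ih => exact ih.imp fun N => supports_mu

end PreFormula
end Structure
end NomHML

namespace NomHML

/-! ## The interpretation of formulas -/

section Interpretation

variable {𝒩 : Type u} [NameSpace 𝒩] {S : NTS 𝒩}

theorem Step.smul {P Q : S.State} {α : S.Act} (h : Step S P α Q) (π : NPerm 𝒩) :
    Step S (π • P) (π • α) (π • Q) := S.trans_smul π P _ _ α Q (S.bn_smul π α) h

/-- The binding names of a transition can be renamed. -/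
theorem Step.rename {P Q : S.State} {α : S.Act} (h : Step S P α Q) {π : NPerm 𝒩}
    (hα : ∀ a ∉ S.bn α, π • a ≠ a → a ∉ supp 𝒩 (α, Q)) : Step S P (π • α) (π • Q) := by
  have e : NameAbs.mk (S.bn α) (α, Q) = NameAbs.mk (S.bn (π • α)) (π • α, π • Q) := by
    refine Quotient.sound ⟨π, S.bn_smul π α, rfl, ?_⟩
    rintro a ⟨h1, h2⟩
    by_contra hne
    exact hα a h2 hne h1
  change (P, _) ∈ S.trans
  rw [← e]
  exact h

namespace PreFormula

theorem interp_conj {ι : Type u} (A : ι → PreFormula S) (ε : ℕ → Set S.State) :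
    interp (conj A) ε = ⋂ i, interp (A i) ε := by
  have h : conj A = mk (Raw.conj ι fun i => (A i).out) := rfl
  have h2 : ∀ i, interp (A i) ε = Raw.interp (A i).out ε := fun i => by
    conv_lhs => rw [← mk_out (A i)]
    rfl
  rw [h]
  change Raw.interp _ ε = _
  simp only [Raw.interp, h2]

theorem interp_neg (A : PreFormula S) (ε : ℕ → Set S.State) :
    interp (neg A) ε = (interp A ε)ᶜ := by
  induction A using mk_ind with | _ R =>
  change Raw.interp _ ε = _
  simp only [Raw.interp]
  rfl

theorem interp_pred (φ : S.Pred) (ε : ℕ → Set S.State) :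
    interp (pred φ) ε = {P | S.Entails P φ} := by
  change Raw.interp _ ε = _
  simp only [Raw.interp]

theorem interp_var (X : ℕ) (ε : ℕ → Set S.State) : interp (var X) ε = ε X := by
  change Raw.interp _ ε = _
  simp only [Raw.interp]

theorem interp_mu (X : ℕ) (A : PreFormula S) (ε : ℕ → Set S.State) :
    interp (mu X A) ε = ⋂₀ {T | FinSupp 𝒩 T ∧ step X A ε T ⊆ T} := by
  induction A using mk_ind with | _ R =>
  change Raw.interp _ ε = _
  simp only [Raw.interp]
  rfl

theorem mem_interp_dia {α : S.Act} {A : PreFormula S} {ε : ℕ → Set S.State} {P : S.State} :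
    P ∈ interp (dia α A) ε ↔ ∃ α' A' P', dia α A = dia α' A' ∧ Fresh (S.bn α' : Set 𝒩) P ∧
      Fresh (S.bn α' : Set 𝒩) ε ∧ Step S P α' P' ∧ P' ∈ interp A' ε := by
  induction A using mk_ind with | _ R =>
  change P ∈ Raw.interp _ ε ↔ _
  simp only [Raw.interp, Set.mem_ofPred_eq]
  constructor
  · rintro ⟨α', R', P', h, h'⟩
    exact ⟨α', mk R', P', mk_eq_mk.2 h, h'.1, h'.2.1, h'.2.2⟩
  · rintro ⟨α', A', P', h, h'⟩
    induction A' using mk_ind with | _ R' =>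
    exact ⟨α', R', P', mk_eq_mk.1 h, h'⟩

theorem interp_disj {ι : Type u} (A : ι → PreFormula S) (ε : ℕ → Set S.State) :
    interp (disj A) ε = ⋃ i, interp (A i) ε := by
  simp [disj, interp_neg, interp_conj, Set.compl_iInter]

theorem interp_bot (ε : ℕ → Set S.State) : interp bot ε = ∅ := by
  have : IsEmpty PEmpty.{u + 1} := inferInstance
  simp [bot, interp_neg, interp_conj]

theorem smul_sInter {X : Type*} [MulAction (NPerm 𝒩) X] (π : NPerm 𝒩) (s : Set (Set X)) :
    π • ⋂₀ s = ⋂₀ (π • s) := by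
  ext x
  simp only [Set.mem_smul_set_iff_inv_smul_mem, Set.mem_sInter]
  constructor
  · intro h T hT
    have := h _ hT
    rwa [Set.mem_smul_set_iff_inv_smul_mem, inv_inv, smul_inv_smul] at this
  · intro h T hT
    have := h (π • T) (by rwa [inv_smul_smul])
    rwa [Set.mem_smul_set_iff_inv_smul_mem] at this

theorem smul_update (π : NPerm 𝒩) (ε : ℕ → Set S.State) (X : ℕ) (T : Set S.State) :
    π • Function.update ε X T = Function.update (π • ε) X (π • T) := by
  funext Y
  by_cases h : Y = X
  · subst h; simp
  · simp [h]

/-- The interpretation is equivariant. -/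
theorem interp_smul (π : NPerm 𝒩) (A : PreFormula S) (ε : ℕ → Set S.State) :
    interp (π • A) (π • ε) = π • interp A ε := by
  induction A using induction_perm generalizing ε π with
  | conj A ih =>
    simp only [smul_conj, interp_conj, ih, Set.smul_set_iInter]
  | neg A ih =>
    rw [smul_neg, interp_neg, interp_neg, ih, Set.smul_set_compl]
  | pred φ =>
    rw [smul_pred, interp_pred, interp_pred]
    ext P
    rw [Set.mem_smul_set_iff_inv_smul_mem]
    constructor
    · intro h
      have := S.entails_smul π⁻¹ _ _ h
      rwa [inv_smul_smul] at this
    · intro h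
      have := S.entails_smul π _ _ h
      rwa [smul_inv_smul] at this
  | var X => rw [smul_var, interp_var, interp_var]; rfl
  | mu X A ih =>
    rw [smul_mu, interp_mu, interp_mu, smul_sInter]
    congr 1
    -- Permuting maps finitely supported prefixed points to such points. Applying this to `π` and to
    -- `π⁻¹` shows that the two families correspond, so no separate converse is needed.
    have key : ∀ (ρ : NPerm 𝒩) (A : PreFormula S) (ε : ℕ → Set S.State) T,
        (∀ (ρ : NPerm 𝒩) ε, interp (ρ • A) (ρ • ε) = ρ • interp A ε) →
        FinSupp 𝒩 T ∧ step X A ε T ⊆ T →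
        FinSupp 𝒩 (ρ • T) ∧ step X (ρ • A) (ρ • ε) (ρ • T) ⊆ ρ • T := by
      rintro ρ A ε T ih ⟨h1, h2⟩
      refine ⟨h1.smul ρ, ?_⟩
      rw [step, ← smul_update, ih]
      exact Set.smul_set_mono h2
    ext T
    rw [Set.mem_smul_set_iff_inv_smul_mem]
    constructor
    · intro h
      have := key π⁻¹ (π • A) (π • ε) T (fun ρ ε => by
        rw [← mul_smul]
        have := ih (ρ * π) (π⁻¹ • ε)
        have h2 := ih π (π⁻¹ • ε)
        rw [mul_smul ρ π (π⁻¹ • ε), smul_inv_smul, mul_smul ρ π (interp _ _), ← h2,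
          smul_inv_smul] at this
        exact this) h
      rwa [inv_smul_smul, inv_smul_smul] at this
    · intro h
      have := key π A ε _ ih h
      rwa [smul_inv_smul] at this
  | dia α A ih =>
    -- One inclusion for arbitrary permutations is enough; the other is the case `π⁻¹`.
    have key : ∀ (ρ : NPerm 𝒩) (α : S.Act) (A : PreFormula S) ε,
        (∀ (τ ρ : NPerm 𝒩) (ε : ℕ → Set S.State),
          interp (ρ • τ • A) (ρ • ε) = ρ • interp (τ • A) ε) →
        ∀ P ∈ interp (dia α A) ε, ρ • P ∈ interp (dia (ρ • α) (ρ • A)) (ρ • ε) := by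
      intro ρ α A ε ih P hP
      obtain ⟨α', A', P', h1, h2, h3, h4, h5⟩ := mem_interp_dia.1 hP
      obtain ⟨τ, rfl, rfl, -⟩ := dia_eq_iff.1 h1
      refine mem_interp_dia.2 ⟨ρ • τ • α, ρ • τ • A, ρ • P', ?_, ?_, ?_, h4.smul ρ, ?_⟩
      · rw [← smul_dia, h1, smul_dia]
      · exact h2.smul (S.bn_smul _ _)
      · exact h3.smul (S.bn_smul _ _)
      · rw [ih]
        exact Set.smul_mem_smul_set h5
    rw [smul_dia]
    ext P
    rw [Set.mem_smul_set_iff_inv_smul_mem]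
    constructor
    · intro h
      have := key π⁻¹ (π • α) (π • A) (π • ε) (fun τ ρ ε => by
        rw [← mul_smul τ π]; exact ih _ _ _) P h
      simpa only [inv_smul_smul] using this
    · intro h
      have := key π α A ε ih _ h
      rwa [smul_inv_smul] at this

theorem interp_smul_left (π : NPerm 𝒩) (A : PreFormula S) (ε : ℕ → Set S.State) :
    interp (π • A) ε = π • interp A (π⁻¹ • ε) := by
  rw [← interp_smul, smul_inv_smul]

/-- The binding names in the interpretation of `⟨α⟩A` can be chosen outside any given finite
set. -/
theorem mem_interp_dia_fresh {α : S.Act} {A : PreFormula S} (hA : FinSupp 𝒩 A)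
    {ε : ℕ → Set S.State} (hε : FinSupp 𝒩 ε) {P : S.State} (h : P ∈ interp (dia α A) ε)
    (Z : Finset 𝒩) :
    ∃ π : NPerm 𝒩, ∃ P', (∀ a ∈ S.bn (π • α), a ∉ Z) ∧
      (∀ a, π • a ≠ a → a ∈ S.bn α ∨ a ∈ S.bn (π • α)) ∧ dia (π • α) (π • A) = dia α A ∧
      Step S P (π • α) P' ∧ P' ∈ interp (π • A) ε := by
  classical
  obtain ⟨α', A', P', h1, h2, h3, h4, h5⟩ := mem_interp_dia.1 h
  obtain ⟨Zε, hZε⟩ := hε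
  obtain ⟨ZP, hZP⟩ := NominalSet.finSupp (𝒩 := 𝒩) P'
  obtain ⟨Zα, hZα⟩ := NominalSet.finSupp (𝒩 := 𝒩) α'
  have hA' : FinSupp 𝒩 A' := by
    obtain ⟨τ, -, rfl, -⟩ := dia_eq_iff.1 h1
    exact hA.smul τ
  obtain ⟨ZA, hZA⟩ := hA'
  have hZP' : MulAction.Supports (NPerm 𝒩) ((Zα ∪ ZP : Finset 𝒩) : Set 𝒩) (α', P') :=
    fun π hπ => Prod.ext (Supports.mono_finset Finset.subset_union_left hZα π hπ)
      (Supports.mono_finset Finset.subset_union_right hZP π hπ)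
  -- The witness for `h` only has binding names fresh for `P` and `ε`. Action, body and target are
  -- renamed together, which keeps the formula, the residual and the valuation unchanged.
  obtain ⟨ρ, hρ1, hρ2⟩ := NPerm.exists_rename (S.bn α') (Z ∪ Zε ∪ ZP ∪ Zα ∪ ZA)
  simp only [Finset.mem_union, not_or] at hρ1
  have hmv : ∀ a ∉ S.bn α', ρ • a ≠ a → ((((a ∉ Z ∧ a ∉ Zε) ∧ a ∉ ZP) ∧ a ∉ Zα) ∧ a ∉ ZA) := by
    intro a ha hne
    obtain ⟨b, hb, rfl⟩ := (hρ2 a hne).resolve_left ha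
    exact hρ1 b hb
  have e1 : dia (ρ • α') (ρ • A') = dia α' A' := dia_smul fun a ha hne =>
    ⟨fun h => (hmv a ha hne).1.2 (supp_subset hZα h), fun h => (hmv a ha hne).2 (supp_subset hZA h)⟩
  have e2 : Step S P (ρ • α') (ρ • P') := h4.rename fun a ha hne h => by
    have := supp_subset hZP' h
    have := hmv a ha hne
    simp_all
  have e3 : ρ • ε = ε := smul_eq_of_fix_supp fun a ha => by
    by_contra hne
    by_cases hb : a ∈ S.bn α'
    · exact h3 a hb ha
    · exact (hmv a hb hne).1.1.1.2 (supp_subset hZε ha)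
  have e4 : ρ • P' ∈ interp (ρ • A') ε := by
    rw [← e3, interp_smul]
    exact Set.smul_mem_smul_set h5
  -- This returns from the renamed witness to a renaming of the original `α` and `A`.
  obtain ⟨π, hπ1, hπ2, hπ3, -⟩ := exists_smul_of_dia_eq (h1.trans e1.symm)
  refine ⟨π, ρ • P', ?_, ?_, ?_, ?_, ?_⟩
  · rw [hπ1]
    intro a ha
    obtain ⟨b, hb, rfl⟩ := smul_mem_bn.1 ha
    exact (hρ1 b hb).1.1.1.1
  · rw [hπ1]; exact hπ3
  · rw [hπ1, hπ2, e1, h1]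
  · rw [hπ1]; exact e2
  · rw [hπ2]; exact e4

/-- To compare interpretations of `⟨α⟩A` and `⟨α⟩B`, it suffices to compare `A` and `B` up to
renamings of the binding names into names outside a finite set. -/
theorem interp_dia_subset {α : S.Act} {A B : PreFormula S} (hA : FinSupp 𝒩 A) (hB : FinSupp 𝒩 B)
    {ε δ : ℕ → Set S.State} (hε : FinSupp 𝒩 ε) (hδ : FinSupp 𝒩 δ) (Z : Finset 𝒩)
    (h : ∀ π : NPerm 𝒩, (∀ a, π • a ≠ a → a ∈ S.bn α ∨ a ∉ Z) →
      interp (π • A) ε ⊆ interp (π • B) δ) :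
    interp (dia α A) ε ⊆ interp (dia α B) δ := by
  classical
  intro P hP
  obtain ⟨ZB, hZB⟩ := id hB
  obtain ⟨Zδ, hZδ⟩ := id hδ
  obtain ⟨Zα, hZα⟩ := NominalSet.finSupp (𝒩 := 𝒩) α
  obtain ⟨ZP, hZP⟩ := NominalSet.finSupp (𝒩 := 𝒩) P
  obtain ⟨π, P', h1, h2, h3, h4, h5⟩ :=
    mem_interp_dia_fresh hA hε hP (Z ∪ ZB ∪ Zδ ∪ Zα ∪ ZP)
  simp only [Finset.mem_union, not_or] at h1
  refine mem_interp_dia.2 ⟨π • α, π • B, P', ?_, ?_, ?_, h4, ?_⟩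
  · refine (dia_smul fun a ha hne => ?_).symm
    have := h1 a ((h2 a hne).resolve_left ha)
    exact ⟨fun h => this.1.2 (supp_subset hZα h), fun h => this.1.1.1.2 (supp_subset hZB h)⟩
  · exact Fresh.of_supports hZP fun a ha => (h1 a ha).2
  · exact Fresh.of_supports hZδ fun a ha => (h1 a ha).1.1.2
  · exact h π (fun a hne => (h2 a hne).imp id fun h => (h1 a h).1.1.1.1) h5

theorem finSupp_update {ε : ℕ → Set S.State} (hε : FinSupp 𝒩 ε) {T : Set S.State}
    (hT : FinSupp 𝒩 T) (X : ℕ) : FinSupp 𝒩 (Function.update ε X T) := by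
  classical
  obtain ⟨N, hN⟩ := hε
  obtain ⟨M, hM⟩ := hT
  exact ⟨N ∪ M, fun π hπ => by
    rw [smul_update, Supports.mono_finset Finset.subset_union_left hN π hπ,
      Supports.mono_finset Finset.subset_union_right hM π hπ]⟩

/-- The interpretation is monotone in the variables that occur positively and antitone in those
that occur negatively. -/
theorem IsFormula.interp_mono {κ : Cardinal.{u}} {A : PreFormula S} (hA : IsFormula κ A)
    {ε δ : ℕ → Set S.State} (hε : FinSupp 𝒩 ε) (hδ : FinSupp 𝒩 δ)
    (h1 : ∀ X, Occurs X true A → ε X ⊆ δ X) (h2 : ∀ X, Occurs X false A → δ X ⊆ ε X) :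
    interp A ε ⊆ interp A δ := by
  induction hA using isFormula_induction generalizing ε δ with
  | conj A hι hfs hA ih =>
    rw [interp_conj, interp_conj]
    exact Set.iInter_mono fun i => ih i hε hδ (fun X h => h1 X (.conj i h))
      fun X h => h2 X (.conj i h)
  | neg A hA ih =>
    rw [interp_neg, interp_neg]
    exact Set.compl_subset_compl.2 (ih hδ hε (fun X h => h2 X (.neg h)) fun X h => h1 X (.neg h))
  | pred φ => rw [interp_pred, interp_pred]
  | var X => rw [interp_var, interp_var]; exact h1 X .var
  | mu X A hpos hA ih =>
    rw [interp_mu, interp_mu]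
    -- It suffices that prefixed points for `δ` are prefixed for `ε`. The bound variable is
    -- harmless, as both valuations send it to the same set.
    refine Set.sInter_subset_sInter fun T hT => ⟨hT.1, subset_trans ?_ hT.2⟩
    refine ih (finSupp_update hε hT.1 X) (finSupp_update hδ hT.1 X) (fun Y hY => ?_) fun Y hY => ?_
    · by_cases h : Y = X
      · subst h; simp
      · simpa [h] using h1 Y (.mu (Ne.symm h) hY)
    · by_cases h : Y = X
      · subst h; simp
      · simpa [h] using h2 Y (.mu (Ne.symm h) hY)
  | dia α A hA hA' ih =>
    exact interp_dia_subset hA.finSupp hA.finSupp hε hδ ∅ fun π _ => ih π hε hδ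
      (fun X h => h1 X (.dia (occurs_smul_iff.1 h))) fun X h => h2 X (.dia (occurs_smul_iff.1 h))

/-- The interpretation of a closed formula does not depend on the valuation. -/
theorem IsFormula.interp_eq_of_closed {κ : Cardinal.{u}} {A : PreFormula S} (hA : IsFormula κ A)
    (hc : Closed A) {ε δ : ℕ → Set S.State} (hε : FinSupp 𝒩 ε) (hδ : FinSupp 𝒩 δ) :
    interp A ε = interp A δ :=
  (hA.interp_mono hε hδ (fun X h => absurd ⟨_, h⟩ (hc X)) fun X h => absurd ⟨_, h⟩ (hc X)).antisymm
    (hA.interp_mono hδ hε (fun X h => absurd ⟨_, h⟩ (hc X)) fun X h => absurd ⟨_, h⟩ (hc X))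

end PreFormula
end Interpretation
end NomHML

namespace NomHML

/-! ## Transfinite iteration -/

section Iteration

variable {X : Type u} (f : Set X → Set X)

theorem iter_zero : iter f 0 = ∅ := Ordinal.limitRecOn_zero _ _ _

theorem iter_add_one (o : Ordinal.{u}) : iter f (o + 1) = f (iter f o) :=
  Ordinal.limitRecOn_add_one _ _ _ _

theorem iter_limit {l : Ordinal.{u}} (hl : Order.IsSuccLimit l) :
    iter f l = ⋃ (o : Ordinal.{u}) (_ : o < l), iter f o :=
  Ordinal.limitRecOn_limit _ _ _ _ hl

theorem iter_subset_limit {l : Ordinal.{u}} (hl : Order.IsSuccLimit l) {o : Ordinal.{u}}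
    (ho : o < l) : iter f o ⊆ iter f l := by
  rw [iter_limit f hl]
  exact Set.subset_biUnion_of_mem (u := iter f) ho

variable {f} {Q : Set X → Prop} (hf : ∀ T T', Q T → Q T' → T ⊆ T' → f T ⊆ f T')
  (hQ : ∀ o, Q (iter f o))

-- `Q` will be finite support: monotonicity of `F_A^ε` is available only between finitely supported
-- sets, and all iterates have to stay there.
include hf hQ in
theorem iter_subset_add_one (o : Ordinal.{u}) : iter f o ⊆ iter f (o + 1) := by
  induction o using Ordinal.limitRecOn with
  | zero => rw [iter_zero]; exact Set.empty_subset _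
  | add_one o ih =>
    conv_lhs => rw [iter_add_one]
    conv_rhs => rw [iter_add_one]
    exact hf _ _ (hQ _) (hQ _) ih
  | limit l hl ih =>
    intro x hx
    rw [iter_limit f hl] at hx
    simp only [Set.mem_iUnion] at hx
    obtain ⟨o, ho, hx⟩ := hx
    have h1 := ih o ho hx
    rw [iter_add_one] at h1 ⊢
    exact hf _ _ (hQ _) (hQ _) (iter_subset_limit f hl ho) h1

include hf hQ in
theorem iter_mono {o p : Ordinal.{u}} (h : o ≤ p) : iter f o ⊆ iter f p := by
  induction p using Ordinal.limitRecOn with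
  | zero => rw [le_antisymm h zero_le]
  | add_one p ih =>
    rcases h.lt_or_eq with h | rfl
    · exact (ih (Order.lt_add_one_iff.1 h)).trans (iter_subset_add_one hf hQ p)
    · exact subset_rfl
  | limit l hl _ =>
    rcases h.lt_or_eq with h | rfl
    · exact iter_subset_limit f hl h
    · exact subset_rfl

include hf hQ in
theorem iter_subset_of_prefixed {T : Set X} (hT : Q T) (h : f T ⊆ T) (o : Ordinal.{u}) :
    iter f o ⊆ T := by
  induction o using Ordinal.limitRecOn with
  | zero => rw [iter_zero]; exact Set.empty_subset _
  | add_one o ih => rw [iter_add_one]; exact (hf _ _ (hQ _) hT ih).trans h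
  | limit l hl ih => rw [iter_limit f hl]; exact Set.iUnion₂_subset ih

include hf hQ in
/-- The iterates become stationary at an ordinal of cardinality at most `#X`. -/
theorem exists_iter_fixed : ∃ o : Ordinal.{u}, o.card ≤ #X ∧ f (iter f o) = iter f o := by
  -- Each non-stationary stage contributes an element absent from it and present in all later
  -- stages, so distinct stages choose distinct elements.
  have hinj : ∀ s : Set Ordinal.{u}, (∀ o ∈ s, f (iter f o) ≠ iter f o) →
      ∃ g : s → X, Function.Injective g := by
    intro s hs
    have h : ∀ o : s, ∃ x, x ∈ iter f (o + 1) ∧ x ∉ iter f o := by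
      intro o
      by_contra hcon
      push Not at hcon
      have := (iter_subset_add_one hf hQ o).antisymm hcon
      rw [iter_add_one] at this
      exact hs o o.2 this.symm
    choose g hg using h
    refine ⟨g, fun a b hab => ?_⟩
    have key : ∀ a b : s, g a = g b → ¬ (a : Ordinal.{u}) < b := fun a b hab hlt =>
      (hg b).2 (iter_mono hf hQ (Order.add_one_le_of_lt hlt) (hab ▸ (hg a).1))
    exact Subtype.ext (le_antisymm (not_lt.1 (key b a hab.symm)) (not_lt.1 (key a b hab)))
  -- Otherwise all ordinals of the universe would inject into `X`.
  have hex : ∃ o : Ordinal.{u}, f (iter f o) = iter f o := by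
    by_contra hcon
    push Not at hcon
    obtain ⟨g, hg⟩ := hinj Set.univ fun o _ => hcon o
    exact not_injective_of_ordinal (fun o => g ⟨o, trivial⟩) fun a b h =>
      congrArg Subtype.val (hg h)
  -- All stages before the least stationary one are non-stationary, so they inject into `X`.
  refine ⟨sInf {o | f (iter f o) = iter f o}, ?_, csInf_mem hex⟩
  obtain ⟨g, hg⟩ := hinj (Set.Iio (sInf {o | f (iter f o) = iter f o}))
    fun o ho h => notMem_of_lt_csInf' (s := {o | f (iter f o) = iter f o}) ho h
  have : Function.Injective fun i : (sInf {o | f (iter f o) = iter f o}).ToType =>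
      g (Ordinal.ToType.mk.symm i) := hg.comp (Equiv.injective _)
  simpa using Cardinal.mk_le_of_injective this

end Iteration

/-! ### Convergence of the iterates of a formula. -/

section Convergence

variable {𝒩 : Type u} [NameSpace 𝒩] {S : NTS 𝒩}

theorem step_smul (π : NPerm 𝒩) (X : ℕ) (A : PreFormula S) (ε : ℕ → Set S.State)
    (T : Set S.State) : step X (π • A) (π • ε) (π • T) = π • step X A ε T := by
  rw [step, ← smul_update, interp_smul]; rfl

theorem iter_step_smul (π : NPerm 𝒩) (X : ℕ) (A : PreFormula S) (ε : ℕ → Set S.State)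
    (o : Ordinal.{u}) : iter (step X (π • A) (π • ε)) o = π • iter (step X A ε) o := by
  induction o using Ordinal.limitRecOn with
  | zero => rw [iter_zero, iter_zero, Set.smul_set_empty]
  | add_one o ih => rw [iter_add_one, iter_add_one, ih, step_smul]
  | limit l hl ih =>
    rw [iter_limit _ hl, iter_limit _ hl]
    simp only [Set.smul_set_iUnion]
    exact Set.iUnion₂_congr ih

/-- Iterates are equivariant in the formula and the valuation, so one finite set supports all of
them. This uniformity matters at limits, where a union of finitely supported sets need not be
finitely supported. -/
theorem finSupp_iter_step {X : ℕ} {A : PreFormula S} (hA : FinSupp 𝒩 A) {ε : ℕ → Set S.State}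
    (hε : FinSupp 𝒩 ε) (o : Ordinal.{u}) : FinSupp 𝒩 (iter (step X A ε) o) := by
  classical
  obtain ⟨N, hN⟩ := hA
  obtain ⟨M, hM⟩ := hε
  refine ⟨N ∪ M, fun π hπ => ?_⟩
  rw [← iter_step_smul, Supports.mono_finset Finset.subset_union_left hN π hπ,
    Supports.mono_finset Finset.subset_union_right hM π hπ]

theorem conv_smul (π : NPerm 𝒩) (X : ℕ) (A : PreFormula S) (ε : ℕ → Set S.State) :
    conv X (π • A) (π • ε) = conv X A ε := by
  have key : ∀ (π : NPerm 𝒩) (A : PreFormula S) (ε : ℕ → Set S.State) (o : Ordinal.{u}),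
      IsLeast {T | FinSupp 𝒩 T ∧ step X A ε T = T} (iter (step X A ε) o) →
      IsLeast {T | FinSupp 𝒩 T ∧ step X (π • A) (π • ε) T = T}
        (iter (step X (π • A) (π • ε)) o) := by
    rintro π A ε o ⟨⟨h1, h2⟩, h3⟩
    rw [iter_step_smul]
    refine ⟨⟨h1.smul π, by rw [step_smul, h2]⟩, fun T hT => ?_⟩
    have : iter (step X A ε) o ⊆ π⁻¹ • T := h3 ⟨hT.1.smul _, by
      have := step_smul π⁻¹ X (π • A) (π • ε) T
      rwa [inv_smul_smul, inv_smul_smul, hT.2] at this⟩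
    exact Set.smul_set_subset_iff_subset_inv_smul_set.2 this
  rw [conv, conv]
  congr 1
  ext o
  refine ⟨fun h => ?_, key π A ε o⟩
  have := key π⁻¹ _ _ _ h
  rwa [inv_smul_smul, inv_smul_smul] at this

theorem Conv_smul (π : NPerm 𝒩) (X : ℕ) (A : PreFormula S) (E : Set (ℕ → Set S.State)) :
    Conv X (π • A) (π • E) = Conv X A E := by
  rw [Conv, Conv, ← Set.image_smul, Set.image_image]
  simp only [conv_smul]

theorem extend_smul (π : NPerm 𝒩) (X : ℕ) (A : PreFormula S) (E : Set (ℕ → Set S.State)) :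
    extend X (π • A) (π • E) = π • extend X A E := by
  have key : ∀ (π : NPerm 𝒩) (A : PreFormula S) E, π • extend X A E ⊆
      extend X (π • A) (π • E) := by
    rintro π A E _ ⟨_, ⟨ε, hε, o, ho, rfl⟩, rfl⟩
    refine ⟨π • ε, Set.smul_mem_smul_set hε, o, by rwa [conv_smul], ?_⟩
    rw [iter_step_smul]
    exact smul_update _ _ _ _
  refine (key π A E).antisymm' ?_
  have := key π⁻¹ (π • A) (π • E)
  rw [inv_smul_smul, inv_smul_smul] at this
  rwa [Set.smul_set_subset_iff_subset_inv_smul_set, inv_inv] at this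

theorem finSupp_extend {X : ℕ} {A : PreFormula S} (hA : FinSupp 𝒩 A)
    {E : Set (ℕ → Set S.State)} (hE : FinSupp 𝒩 E) : FinSupp 𝒩 (extend X A E) := by
  classical
  obtain ⟨N, hN⟩ := hA
  obtain ⟨M, hM⟩ := hE
  refine ⟨N ∪ M, fun π hπ => ?_⟩
  rw [← extend_smul, Supports.mono_finset Finset.subset_union_left hN π hπ,
    Supports.mono_finset Finset.subset_union_right hM π hπ]

theorem isValuation_extend {X : ℕ} {A : PreFormula S} (hA : FinSupp 𝒩 A)
    {E : Set (ℕ → Set S.State)} (hE : ∀ ε ∈ E, IsValuation ε) :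
    ∀ ε ∈ extend X A E, IsValuation ε := by
  rintro _ ⟨ε, hε, o, -, rfl⟩
  exact finSupp_update (hE ε hε) (finSupp_iter_step hA (hE ε hε) o) X

section Positive

variable {κ : Cardinal.{u}} {X : ℕ} {A : PreFormula S} (hA : IsFormula κ A)
  (hpos : ¬ Occurs X false A) {ε : ℕ → Set S.State} (hε : IsValuation ε)

include hA hpos hε

theorem step_mono (T T' : Set S.State) (hT : FinSupp 𝒩 T) (hT' : FinSupp 𝒩 T') (h : T ⊆ T') :
    step X A ε T ⊆ step X A ε T' := by
  refine hA.interp_mono (finSupp_update hε hT X) (finSupp_update hε hT' X) (fun Y _ => ?_)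
    fun Y hY => ?_
  · by_cases e : Y = X
    · subst e; simpa
    · simp [e]
  · have e : Y ≠ X := by rintro rfl; exact hpos hY
    simp [e]

theorem iter_step_mono {o p : Ordinal.{u}} (h : o ≤ p) :
    iter (step X A ε) o ⊆ iter (step X A ε) p :=
  iter_mono (Q := FinSupp 𝒩) (step_mono hA hpos hε) (finSupp_iter_step hA.finSupp hε) h

theorem iter_step_subset {T : Set S.State} (hT : FinSupp 𝒩 T) (h : step X A ε T ⊆ T)
    (o : Ordinal.{u}) : iter (step X A ε) o ⊆ T :=
  iter_subset_of_prefixed (Q := FinSupp 𝒩) (step_mono hA hpos hε)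
    (finSupp_iter_step hA.finSupp hε) hT h o

theorem isLeast_of_step_eq {o : Ordinal.{u}}
    (h : step X A ε (iter (step X A ε) o) = iter (step X A ε) o) :
    IsLeast {T | FinSupp 𝒩 T ∧ step X A ε T = T} (iter (step X A ε) o) :=
  ⟨⟨finSupp_iter_step hA.finSupp hε o, h⟩,
    fun _ hT => iter_step_subset hA hpos hε hT.1 hT.2.le o⟩

/-- A stationary stage exists and is the least fixpoint, so the infimum defining `conv` is over a
non-empty set and is attained. -/
theorem isLeast_conv : IsLeast {T | FinSupp 𝒩 T ∧ step X A ε T = T}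
    (iter (step X A ε) (conv X A ε)) := by
  obtain ⟨o, -, ho⟩ := exists_iter_fixed (Q := FinSupp 𝒩) (step_mono hA hpos hε)
    (finSupp_iter_step hA.finSupp hε)
  exact csInf_mem (s := {o | IsLeast {T | FinSupp 𝒩 T ∧ step X A ε T = T}
    (iter (step X A ε) o)}) ⟨o, isLeast_of_step_eq hA hpos hε ho⟩

theorem card_conv_le : (conv X A ε).card ≤ #S.State := by
  obtain ⟨o, h, ho⟩ := exists_iter_fixed (Q := FinSupp 𝒩) (step_mono hA hpos hε)
    (finSupp_iter_step hA.finSupp hε)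
  exact (Ordinal.card_le_card (csInf_le' (isLeast_of_step_eq hA hpos hε ho))).trans h

theorem iter_step_eq_of_conv_le {o : Ordinal.{u}} (h : conv X A ε ≤ o) :
    iter (step X A ε) o = iter (step X A ε) (conv X A ε) := by
  have := (isLeast_conv hA hpos hε).1
  exact (iter_step_subset hA hpos hε this.1 this.2.le o).antisymm (iter_step_mono hA hpos hε h)

/-- The stationary iterate is a finitely supported prefixed point and lies below every other one, so
it is their intersection. -/
theorem interp_mu_eq_iter : interp (mu X A) ε = iter (step X A ε) (conv X A ε) := by
  rw [interp_mu]
  have := (isLeast_conv hA hpos hε).1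
  have hmem : iter (step X A ε) (conv X A ε) ∈ {T | FinSupp 𝒩 T ∧ step X A ε T ⊆ T} :=
    ⟨this.1, this.2.le⟩
  exact (Set.sInter_subset_of_mem hmem).antisymm
    (Set.subset_sInter fun T hT => iter_step_subset hA hpos hε hT.1 hT.2 _)

end Positive

/-! ### Cardinal bounds from the regularity of `ν`. -/

theorem isRegular_nu : (nu S).IsRegular := by
  rw [nu]
  rcases le_or_gt ℵ₀ #S.State with h | h
  · rw [max_eq_left (h.trans (Order.le_succ _))]
    exact isRegular_succ h
  · rw [max_eq_right (Order.succ_le_of_lt h)]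
    exact isRegular_aleph0

theorem lt_nu_of_le {c : Cardinal.{u}} (h : c ≤ #S.State) : c < nu S :=
  (Order.lt_succ_of_le h).trans_le (le_max_left _ _)

theorem conv_lt {κ : Cardinal.{u}} {X : ℕ} {A : PreFormula S} (hA : IsFormula κ A)
    (hpos : ¬ Occurs X false A) {ε : ℕ → Set S.State} (hε : IsValuation ε) :
    conv X A ε < (nu S).ord :=
  lt_ord.2 (lt_nu_of_le (card_conv_le hA hpos hε))

/-- The extended set is covered by the pairs of some `ε ∈ E` and a stage up to its convergence: a
sum of fewer than `ν` cardinals below the regular `ν`. -/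
theorem mk_extend_lt {κ : Cardinal.{u}} {X : ℕ} {A : PreFormula S} (hA : IsFormula κ A)
    (hpos : ¬ Occurs X false A) {E : Set (ℕ → Set S.State)} (hE : ∀ ε ∈ E, IsValuation ε)
    (hc : #E < nu S) : #(extend X A E) < nu S := by
  -- The successor is needed because the stage `conv X A ε` itself is included.
  let g : (Σ ε : E, (conv X A ε + 1).ToType) → (ℕ → Set S.State) := fun p =>
    Function.update (p.1 : ℕ → Set S.State) X
      (iter (step X A p.1) (Ordinal.ToType.mk.symm p.2 : Ordinal.{u}))
  have hsub : extend X A E ⊆ Set.range g := by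
    rintro _ ⟨ε, hε, o, ho, rfl⟩
    refine ⟨⟨⟨ε, hε⟩, Ordinal.ToType.mk ⟨o, Order.lt_add_one_iff.2 ho⟩⟩, ?_⟩
    simp [g]
  refine ((Cardinal.mk_le_mk_of_subset hsub).trans Cardinal.mk_range_le).trans_lt ?_
  rw [Cardinal.mk_sigma]
  refine sum_lt_of_isRegular isRegular_nu hc fun ε => ?_
  rw [mk_toType, Ordinal.card_add, Ordinal.card_one]
  exact add_lt_of_lt isRegular_nu.aleph0_le (lt_nu_of_le (card_conv_le hA hpos (hE ε ε.2)))
    (one_lt_aleph0.trans_le isRegular_nu.aleph0_le)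

theorem bddAbove_conv (X : ℕ) (A : PreFormula S) (E : Set (ℕ → Set S.State)) :
    BddAbove (conv X A '' E) := Ordinal.bddAbove_of_small

/-- Fewer than `ν` ordinals below `ν` cannot be cofinal in it. -/
theorem Conv_lt {κ : Cardinal.{u}} {X : ℕ} {A : PreFormula S} (hA : IsFormula κ A)
    (hpos : ¬ Occurs X false A) {E : Set (ℕ → Set S.State)} (hE : ∀ ε ∈ E, IsValuation ε)
    (hc : #E < nu S) : Conv X A E < (nu S).ord := by
  rw [Conv, sSup_image']
  exact Ordinal.iSup_lt_of_lt_cof (by rwa [isRegular_nu.cof_ord]) fun ε => conv_lt hA hpos (hE ε ε.2)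

end Convergence
end NomHML

namespace NomHML

/-! ## Equivariant functional relations on formulas -/

section Functional

variable {𝒩 : Type u} [NameSpace 𝒩] {S : NTS 𝒩}

/-- `B` is the only formula related to `A`. -/
def UniqueImage (R : PreFormula S → PreFormula S → Prop) (A B : PreFormula S) : Prop :=
  R A B ∧ ∀ B', R A B' → B' = B

variable {Y : Type*} [MulAction (NPerm 𝒩) Y] {R : Y → PreFormula S → PreFormula S → Prop}

/-- A permutation fixing parameter and input sends the output to another output for the same data,
which uniqueness identifies with the first. -/
theorem supports_of_uniqueImage
    (hR : ∀ (π : NPerm 𝒩) c A B, R c A B → R (π • c) (π • A) (π • B)) {c : Y}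
    {A B : PreFormula S} (h : UniqueImage (R c) A B) {N : Set 𝒩}
    (hc : MulAction.Supports (NPerm 𝒩) N c) (hA : MulAction.Supports (NPerm 𝒩) N A) :
    MulAction.Supports (NPerm 𝒩) N B := fun π hπ => h.2 _ <| by
  have := hR π _ _ _ h.1
  rwa [hc π hπ, hA π hπ] at this

/-- This makes the clause for `⟨α⟩A` independent of the fresh representative. The permutation
linking two of them moves only names fresh for the parameter, so it carries one output body to the
other. -/
theorem dia_eq_of_uniqueImage
    (hR : ∀ (π : NPerm 𝒩) c A B, R c A B → R (π • c) (π • A) (π • B)) {c : Y}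
    {α β : S.Act} {A A' B B' : PreFormula S} (h : UniqueImage (R c) A B)
    (h' : R c A' B') (hd : dia α A = dia β A') (hα : Fresh (S.bn α : Set 𝒩) c)
    (hβ : Fresh (S.bn β : Set 𝒩) c) : dia β B' = dia α B := by
  classical
  obtain ⟨π, rfl, rfl, h1, h2⟩ := exists_smul_of_dia_eq hd
  have hπc : π • c = c := hα.smul_eq hβ h1
  have hB : B' = π • B := by
    have := hR π⁻¹ _ _ _ h'
    rw [inv_smul_smul, inv_smul_eq_iff.2 hπc.symm] at this
    rw [← h.2 _ this, smul_inv_smul]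
  rw [hB]
  refine dia_smul fun a ha hne => ?_
  have hb := (h1 a hne).resolve_left ha
  refine ⟨(h2 a ha hb).1, notMem_supp_iff.2 ?_⟩
  -- A binding name new in `β` is fresh for the input and for the parameter; the union of supports
  -- omitting it supports the output.
  obtain ⟨N, hN, haN⟩ := notMem_supp_iff.1 (h2 a ha hb).2
  obtain ⟨M, hM, haM⟩ := notMem_supp_iff.1 (hβ a hb)
  refine ⟨N ∪ M, supports_of_uniqueImage hR h (Supports.mono_finset Finset.subset_union_right hM)
    (Supports.mono_finset Finset.subset_union_left hN), by simp [haN, haM]⟩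

theorem conj_eq_of_uniqueImage {R : PreFormula S → PreFormula S → Prop} {ι κ : Type u}
    {A B : ι → PreFormula S} {A' B' : κ → PreFormula S} (h : ∀ i, UniqueImage R (A i) (B i))
    (h' : ∀ i, R (A' i) (B' i)) (hc : conj A = conj A') : conj B' = conj B := by
  rw [conj_eq_iff] at hc ⊢
  apply Set.Subset.antisymm
  · rintro _ ⟨j, rfl⟩
    obtain ⟨i, hi⟩ : A' j ∈ Set.range A := hc ▸ Set.mem_range_self j
    exact ⟨i, ((h i).2 _ (hi ▸ h' j)).symm⟩
  · rintro _ ⟨i, rfl⟩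
    obtain ⟨j, hj⟩ : A i ∈ Set.range A' := hc ▸ Set.mem_range_self i
    exact ⟨j, (h i).2 _ (hj ▸ h' j)⟩

theorem supports_set {X : Type*} [MulAction (NPerm 𝒩) X] {N : Set 𝒩} {T : Set X}
    (h : ∀ π : NPerm 𝒩, (∀ a ∈ N, π • a = a) → ∀ x ∈ T, π • x ∈ T) :
    MulAction.Supports (NPerm 𝒩) N T := by
  intro π hπ
  ext x
  rw [Set.mem_smul_set_iff_inv_smul_mem]
  refine ⟨fun hx => ?_, h π⁻¹ (fun a ha => inv_smul_eq_iff.2 (hπ ha).symm) x⟩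
  simpa using h π (fun a ha => hπ ha) _ hx

/-- Permutations fixing the parameter and the set of inputs permute the inputs, hence also the
outputs. This keeps encoded and substituted conjunctions finitely supported. -/
theorem finSupp_range_of_uniqueImage
    (hR : ∀ (π : NPerm 𝒩) c A B, R c A B → R (π • c) (π • A) (π • B)) {c : Y} (hc : FinSupp 𝒩 c)
    {ι : Type*} {A B : ι → PreFormula S} (hA : FinSupp 𝒩 (Set.range A))
    (h : ∀ i, UniqueImage (R c) (A i) (B i)) : FinSupp 𝒩 (Set.range B) := by
  classical
  obtain ⟨N, hN⟩ := hA
  obtain ⟨M, hM⟩ := hc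
  refine ⟨N ∪ M, supports_set fun π hπ => ?_⟩
  rintro _ ⟨i, rfl⟩
  have e1 : π • c = c := Supports.mono_finset Finset.subset_union_right hM π hπ
  have e2 : π • Set.range A = Set.range A :=
    Supports.mono_finset Finset.subset_union_left hN π hπ
  obtain ⟨j, hj⟩ : π • A i ∈ Set.range A := e2 ▸ Set.smul_mem_smul_set (Set.mem_range_self i)
  have := hR π _ _ _ (h i).1
  rw [e1, ← hj] at this
  exact ⟨j, ((h j).2 _ this).symm⟩

end Functional

/-! ## Substitution and unrolling -/

section Unrolling

variable {𝒩 : Type u} [NameSpace 𝒩] {S : NTS 𝒩}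

theorem freeIn_smul_iff {X : ℕ} {A : PreFormula S} {π : NPerm 𝒩} :
    FreeIn X (π • A) ↔ FreeIn X A :=
  ⟨fun ⟨b, h⟩ => ⟨b, occurs_smul_iff.1 h⟩, fun ⟨b, h⟩ => ⟨b, h.smul π⟩⟩

theorem Subst.smul {X : ℕ} {C A B : PreFormula S} (h : Subst X C A B) (π : NPerm 𝒩) :
    Subst X (π • C) (π • A) (π • B) := by
  induction h with
  | conj _ ih => rw [smul_conj, smul_conj]; exact .conj ih
  | neg _ ih => rw [PreFormula.smul_neg, PreFormula.smul_neg]; exact .neg ih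
  | pred φ => exact .pred _
  | dia hα _ ih => rw [smul_dia, smul_dia]; exact .dia (hα.smul (S.bn_smul _ _)) ih
  | var_self => exact .var_self
  | var hY => exact .var hY
  | mu_self => rw [smul_mu]; exact .mu_self
  | mu hY hC _ ih =>
    rw [smul_mu, smul_mu]
    exact .mu hY (fun h => hC (freeIn_smul_iff.1 h)) ih

theorem finSupp_interp {A : PreFormula S} (hA : FinSupp 𝒩 A) {ε : ℕ → Set S.State}
    (hε : FinSupp 𝒩 ε) : FinSupp 𝒩 (interp A ε) := by
  classical
  obtain ⟨N, hN⟩ := hA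
  obtain ⟨M, hM⟩ := hε
  refine ⟨N ∪ M, fun π hπ => ?_⟩
  rw [← interp_smul, Supports.mono_finset Finset.subset_union_left hN π hπ,
    Supports.mono_finset Finset.subset_union_right hM π hπ]

/-- Substitution of a fixpoint-free formula in a fixpoint-free formula. -/
theorem exists_subst {κ : Cardinal.{u}} {A C : PreFormula S} (hA : IsFormula κ A)
    (hf : FixFree A) (hC : IsFormula κ C) (hCf : FixFree C) (X : ℕ) :
    ∃ B, UniqueImage (Subst X C) A B ∧ IsFormula κ B ∧ FixFree B ∧
      (∀ Y b, Occurs Y b B → (Y ≠ X ∧ Occurs Y b A) ∨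
        ∃ b₁ b₂, Occurs X b₁ A ∧ Occurs Y b₂ C ∧ b = (b₁ == b₂)) ∧
      ∀ ε, IsValuation ε → interp B ε = interp A (Function.update ε X (interp C ε)) := by
  have hR : ∀ (π : NPerm 𝒩) (c A B : PreFormula S), Subst X c A B →
    Subst X (π • c) (π • A) (π • B) := fun π _ _ _ h => h.smul π
  induction hA using isFormula_induction with
  | conj A hι hfs hA ih =>
    choose B h1 h2 h3 h4 h5 using fun i => ih i (fixFree_conj_iff.1 hf i)
    refine ⟨conj B, ⟨.conj fun i => (h1 i).1, fun D hD => ?_⟩,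
      .conj hι (finSupp_range_of_uniqueImage hR hC.finSupp hfs h1) h2, .conj h3, ?_, ?_⟩
    · generalize hE : conj A = F at hD
      cases hD with
      | conj h => exact conj_eq_of_uniqueImage h1 h hE
      | _ => exact absurd (congrArg head hE) (by simp)
    · intro Y b h
      obtain ⟨i, h⟩ := occurs_conj_iff.1 h
      rcases h4 i Y b h with ⟨h, h'⟩ | ⟨b₁, b₂, h, h'⟩
      · exact Or.inl ⟨h, .conj i h'⟩
      · exact Or.inr ⟨b₁, b₂, .conj i h, h'⟩
    · intro ε hε
      simp only [interp_conj, h5 _ ε hε]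
  | neg A hA ih =>
    obtain ⟨B, h1, h2, h3, h4, h5⟩ := ih (fixFree_neg_iff.1 hf)
    refine ⟨neg B, ⟨.neg h1.1, fun D hD => ?_⟩, .neg h2, .neg h3, ?_, ?_⟩
    · generalize hE : neg A = F at hD
      cases hD with
      | neg h =>
        obtain rfl := neg_injective hE
        rw [h1.2 _ h]
      | _ => exact absurd (congrArg head hE) (by simp)
    · intro Y b h
      rcases h4 Y _ (occurs_neg_iff.1 h) with ⟨h, h'⟩ | ⟨b₁, b₂, h, h', e⟩
      · exact Or.inl ⟨h, occurs_neg_iff.2 h'⟩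
      -- The sign of an occurrence inside a substituted `C` is the product of the signs of `X` in
      -- `A` and of `Y` in `C`; a negation flips only the first factor.
      · refine Or.inr ⟨!b₁, b₂, .neg h, h', ?_⟩
        revert e
        cases b <;> cases b₁ <;> cases b₂ <;> simp
    · intro ε hε
      rw [interp_neg, interp_neg, h5 ε hε]
  | pred φ =>
    refine ⟨pred φ, ⟨.pred φ, fun D hD => ?_⟩, .pred φ, .pred φ,
      fun Y b h => absurd h not_occurs_pred, fun ε _ => by rw [interp_pred, interp_pred]⟩
    generalize hE : (pred φ : PreFormula S) = F at hD
    cases hD with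
    | pred ψ => rfl
    | _ => exact absurd (congrArg head hE) (by simp)
  | var Z =>
    by_cases hZ : Z = X
    · subst hZ
      refine ⟨C, ⟨.var_self, fun D hD => ?_⟩, hC, hCf, fun Y b h =>
        Or.inr ⟨true, b, .var, h, by simp⟩, fun ε _ => by rw [interp_var]; simp⟩
      generalize hE : (var Z : PreFormula S) = F at hD
      cases hD with
      | var_self => rfl
      | var hY => exact absurd (var_injective hE).symm hY
      | _ => exact absurd (congrArg head hE) (by simp)
    · refine ⟨var Z, ⟨.var hZ, fun D hD => ?_⟩, .var Z, .var Z, fun Y b h =>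
        Or.inl ⟨?_, h⟩, fun ε _ => by rw [interp_var, interp_var]; simp [hZ]⟩
      · generalize hE : (var Z : PreFormula S) = F at hD
        cases hD with
        | var_self => exact absurd (var_injective hE) hZ
        | var hY => rfl
        | _ => exact absurd (congrArg head hE) (by simp)
      · rw [← (occurs_var_iff.1 h).1]
        exact hZ
  | mu Z A hpos hA ih => exact absurd hf not_fixFree_mu
  | dia α A hA hA' ih =>
    obtain ⟨N, hN⟩ := hC.finSupp
    obtain ⟨π, hd, hfr⟩ := exists_fresh_dia α hA.finSupp N
    have hα : Fresh (S.bn (π • α) : Set 𝒩) C := Fresh.of_supports hN hfr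
    rw [← hd] at hf ⊢
    obtain ⟨B, h1, h2, h3, h4, h5⟩ := ih π (fixFree_dia_iff.1 hf)
    refine ⟨dia (π • α) B, ⟨.dia hα h1.1, fun D hD => ?_⟩, .dia _ h2, .dia _ h3, ?_, ?_⟩
    · generalize hE : dia (π • α) (π • A) = F at hD
      cases hD with
      | dia hβ h => exact dia_eq_of_uniqueImage hR h1 h hE hα hβ
      | _ => exact absurd (congrArg head hE) (by simp)
    · intro Y b h
      rcases h4 Y b (occurs_dia_iff.1 h) with ⟨h, h'⟩ | ⟨b₁, b₂, h, h'⟩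
      · exact Or.inl ⟨h, .dia h'⟩
      · exact Or.inr ⟨b₁, b₂, .dia h, h'⟩
    · intro ε hε
      have hε' : FinSupp 𝒩 (Function.update ε X (interp C ε)) :=
        finSupp_update hε (finSupp_interp hC.finSupp hε) X
      -- `ρ` fixes `C` but may move `ε`, so the induction hypothesis is used at `ρ⁻¹ • ε`.
      have key : ∀ ρ : NPerm 𝒩, (∀ a, ρ • a ≠ a → a ∈ S.bn (π • α) ∨ a ∉ N) →
          interp (ρ • B) ε = interp (ρ • π • A) (Function.update ε X (interp C ε)) := by
        intro ρ hρ
        have hC : ρ • C = C := hN ρ fun a ha => by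
          by_contra hne
          exact (hρ a hne).elim (fun h => hfr a h ha) fun h => h ha
        have hv : IsValuation (ρ⁻¹ • ε) := FinSupp.smul hε _
        rw [interp_smul_left, h5 _ hv, ← interp_smul, smul_update, smul_inv_smul, ← interp_smul,
          hC, smul_inv_smul]
      exact (interp_dia_subset h2.finSupp (hA' π).finSupp hε hε' N fun ρ hρ =>
        (key ρ hρ).le).antisymm (interp_dia_subset (hA' π).finSupp h2.finSupp hε' hε N
          fun ρ hρ => (key ρ hρ).ge)

theorem Unroll.smul {X : ℕ} {A B : PreFormula S} {o : Ordinal.{u}} (h : Unroll X A o B)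
    (π : NPerm 𝒩) : Unroll X (π • A) o (π • B) := by
  induction h with
  | zero => rw [smul_bot]; exact .zero
  | succ _ h ih => exact .succ ih (h.smul π)
  | limit hl _ ih => rw [smul_disj]; exact .limit hl ih

theorem Unroll.exists_of_limit {X : ℕ} {A D : PreFormula S} {l : Ordinal.{u}}
    (h : Unroll X A l D) (hl : Order.IsSuccLimit l) :
    ∃ B : l.ToType → PreFormula S, D = disj B ∧ ∀ i, Unroll X A (i.toOrd : Ordinal.{u}) (B i) := by
  cases h with
  | zero => exact absurd rfl hl.ne_bot
  | succ => exact absurd hl (Order.not_isSuccLimit_succ _)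
  | limit _ h => exact ⟨_, rfl, h⟩

theorem isFormula_bot {κ : Cardinal.{u}} (hκ : ℵ₀ < κ) : IsFormula κ (bot : PreFormula S) := by
  refine .neg (.conj ?_ ⟨∅, fun π _ => ?_⟩ fun i => i.elim)
  · simpa using aleph0_pos.trans hκ
  · simp [Set.range_eq_empty]

theorem fixFree_bot : FixFree (bot : PreFormula S) := .neg (.conj fun i => i.elim)

theorem not_occurs_bot {X : ℕ} {b : Bool} : ¬ Occurs X b (bot : PreFormula S) := fun h => by
  obtain ⟨i, -⟩ := occurs_conj_iff.1 (occurs_neg_iff.1 h)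
  exact i.elim

theorem occurs_disj_iff {X : ℕ} {b : Bool} {ι : Type u} {A : ι → PreFormula S} :
    Occurs X b (disj A) ↔ ∃ i, Occurs X b (A i) := by
  simp [disj, occurs_neg_iff, occurs_conj_iff]

/-- The unrollings of `μX.A` are well-defined; they are interpreted by the iterates. -/
theorem exists_unroll {κ : Cardinal.{u}} (hκ : ℵ₀ < κ) {X : ℕ} {A : PreFormula S}
    (hA : IsFormula κ A) (hpos : ¬ Occurs X false A) (hf : FixFree A) (o : Ordinal.{u})
    (ho : o.card < κ) :
    ∃ B, (Unroll X A o B ∧ ∀ B', Unroll X A o B' → B' = B) ∧ IsFormula κ B ∧ FixFree B ∧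
      (∀ Y b, Occurs Y b B → Y ≠ X ∧ Occurs Y b A) ∧
      ∀ ε, IsValuation ε → interp B ε = iter (step X A ε) o := by
  induction o using Ordinal.limitRecOn with
  | zero =>
    refine ⟨bot, ⟨.zero, fun D hD => ?_⟩, isFormula_bot hκ, fixFree_bot,
      fun Y b h => absurd h not_occurs_bot, fun ε _ => by rw [interp_bot, iter_zero]⟩
    generalize hE : (0 : Ordinal.{u}) = p at hD
    cases hD with
    | zero => rfl
    | @succ q => exact absurd hE.symm (by simp)
    | limit hl => exact absurd hE.symm hl.ne_bot
  | add_one o ih =>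
    obtain ⟨B, h1, h2, h3, h4, h5⟩ := ih ((Ordinal.card_le_card (Order.le_succ o)).trans_lt ho)
    obtain ⟨C, c1, c2, c3, c4, c5⟩ := exists_subst hA hf h2 h3 X
    refine ⟨C, ⟨.succ h1.1 c1.1, fun D hD => ?_⟩, c2, c3, fun Y b h => ?_, fun ε hε => ?_⟩
    · generalize hE : o + 1 = p at hD
      cases hD with
      | zero => exact absurd hE (by simp)
      | succ hB hD =>
        have := Order.succ_injective hE
        subst this
        rw [h1.2 _ hB] at hD
        exact c1.2 _ hD
      | limit hl => exact absurd hl (hE ▸ Order.not_isSuccLimit_succ o)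
    -- `X` is positive in `A`, so an occurrence coming from the previous unrolling keeps its sign
    -- there, and the induction hypothesis places it in `A`.
    · rcases c4 Y b h with h | ⟨b₁, b₂, g, g', rfl⟩
      · exact h
      · cases b₁ with
        | false => exact absurd g hpos
        | true => simpa using h4 Y _ g'
    · rw [c5 ε hε, h5 ε hε, iter_add_one]; rfl
  | limit l hl ih =>
    have hlt : ∀ i : l.ToType, (i.toOrd : Ordinal.{u}) < l := fun i => i.toOrd.2
    choose B h1 h2 h3 h4 h5 using fun i : l.ToType =>
      ih _ (hlt i) ((Ordinal.card_le_card (hlt i).le).trans_lt ho)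
    refine ⟨disj B, ⟨.limit hl fun i => (h1 i).1, fun D hD => ?_⟩,
      .neg (.conj (by rwa [mk_toType]) ?_ fun i => .neg (h2 i)), .neg (.conj fun i => .neg (h3 i)),
      fun Y b h => ?_, fun ε hε => ?_⟩
    · obtain ⟨D, rfl, h⟩ := hD.exists_of_limit hl
      congr 1
      funext i
      exact (h1 i).2 _ (h i)
    -- By uniqueness every earlier unrolling is fixed by the permutations that fix a support of `A`,
    -- so the disjuncts have a common finite support.
    · obtain ⟨N, hN⟩ := hA.finSupp
      refine ⟨N, fun π hπ => ?_⟩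
      rw [← Set.image_smul, ← Set.range_comp]
      congr 1
      funext i
      have := (h1 i).1.smul π
      rw [hN π hπ] at this
      simp only [Function.comp_apply]
      rw [PreFormula.smul_neg, (h1 i).2 _ this]
    · obtain ⟨i, h⟩ := occurs_disj_iff.1 h
      exact h4 i Y b h
    · rw [interp_disj, iter_limit _ hl]
      simp only [h5 _ ε hε]
      ext P
      simp only [Set.mem_iUnion]
      constructor
      · rintro ⟨i, hi⟩
        exact ⟨_, hlt i, hi⟩
      · rintro ⟨p, hp, h⟩
        exact ⟨Ordinal.ToType.mk ⟨p, hp⟩, by simpa using h⟩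

end Unrolling
end NomHML

namespace NomHML

/-! ## The encoding -/

section Encoding

variable {𝒩 : Type u} [NameSpace 𝒩] {S : NTS 𝒩}

theorem Encodes.smul {E : Set (ℕ → Set S.State)} {A B : PreFormula S} (h : Encodes E A B)
    (π : NPerm 𝒩) : Encodes (π • E) (π • A) (π • B) := by
  induction h with
  | conj _ ih => rw [smul_conj, smul_conj]; exact .conj ih
  | neg _ ih => rw [PreFormula.smul_neg, PreFormula.smul_neg]; exact .neg ih
  | pred φ => exact .pred _
  | dia hα _ ih => rw [smul_dia, smul_dia]; exact .dia (hα.smul (S.bn_smul _ _)) ih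
  | var X => exact .var X
  | mu _ hC ih =>
    rw [smul_mu]
    rw [← extend_smul] at ih
    have := hC.smul π
    rw [← Conv_smul π] at this
    exact .mu ih this

/-- If `A` and `B` agree on the valuations that arise in the iteration of `A`, they have the same
least fixpoint. -/
theorem iter_step_eq_of_agree {κ : Cardinal.{u}} {X : ℕ} {A B : PreFormula S}
    (hA : IsFormula κ A) (hA' : ¬ Occurs X false A) (hB : IsFormula κ B)
    (hB' : ¬ Occurs X false B) {ε : ℕ → Set S.State} (hε : IsValuation ε)
    (h : ∀ o ≤ conv X A ε, step X B ε (iter (step X A ε) o) = step X A ε (iter (step X A ε) o))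
    {γ : Ordinal.{u}} (hγ : conv X B ε ≤ γ) :
    iter (step X B ε) γ = iter (step X A ε) (conv X A ε) := by
  -- Agreement is assumed only along the iterates of `A`, which suffices: at each step both
  -- functions are applied to the same iterate.
  have key : ∀ o ≤ conv X A ε, iter (step X B ε) o = iter (step X A ε) o := by
    intro o
    induction o using Ordinal.limitRecOn with
    | zero => intro _; rw [iter_zero, iter_zero]
    | add_one o ih =>
      intro ho
      have ho' := (Order.le_succ o).trans ho
      rw [iter_add_one, iter_add_one, ih ho', h o ho']
    | limit l hl ih =>
      intro ho
      rw [iter_limit _ hl, iter_limit _ hl]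
      exact Set.iUnion₂_congr fun o hol => ih o hol (hol.le.trans ho)
  have e := key _ le_rfl
  -- The common iterate is thus a fixpoint for `B`. Being an iterate, it is the least one, whichever
  -- of the two closes first.
  have hfix : step X B ε (iter (step X B ε) (conv X A ε)) = iter (step X B ε) (conv X A ε) := by
    rw [e, h _ le_rfl]
    exact (isLeast_conv hA hA' hε).1.2
  rw [iter_step_eq_of_conv_le hB hB' hε hγ, ← e]
  exact (isLeast_conv hB hB' hε).unique (isLeast_of_step_eq hB hB' hε hfix)

/-- The conclusions are proved together because the fixpoint case needs them all for the body: a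
unique fixpoint-free formula to unroll, unchanged signs for positivity, and agreement on the
extended set of valuations, for which `E` has to vary. -/
theorem exists_encoding {κ : Cardinal.{u}} (hκ : ℵ₀ < κ) (hκS : #S.State < κ) {A : PreFormula S}
    (hA : IsFormula κ A) {E : Set (ℕ → Set S.State)} (hE : ∀ ε ∈ E, IsValuation ε)
    (hEs : FinSupp 𝒩 E) (hEc : #E < nu S) :
    ∃ B, UniqueImage (Encodes E) A B ∧ IsFormula κ B ∧ FixFree B ∧
      (∀ Y b, Occurs Y b B → Occurs Y b A) ∧ ∀ ε ∈ E, interp B ε = interp A ε := by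
  have hR : ∀ (π : NPerm 𝒩) (c : Set (ℕ → Set S.State)) A B, Encodes c A B →
    Encodes (π • c) (π • A) (π • B) := fun π _ _ _ h => h.smul π
  induction hA using isFormula_induction generalizing E with
  | conj A hι hfs hA ih =>
    choose B h1 h2 h3 h4 h5 using fun i => ih i hE hEs hEc
    refine ⟨conj B, ⟨.conj fun i => (h1 i).1, fun D hD => ?_⟩,
      .conj hι (finSupp_range_of_uniqueImage hR hEs hfs h1) h2, .conj h3, ?_, ?_⟩
    · generalize hF : conj A = F at hD
      cases hD with
      | conj h => exact conj_eq_of_uniqueImage h1 h hF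
      | _ => exact absurd (congrArg head hF) (by simp)
    · intro Y b h
      obtain ⟨i, h⟩ := occurs_conj_iff.1 h
      exact .conj i (h4 i Y b h)
    · intro ε hε
      simp only [interp_conj, h5 _ ε hε]
  | neg A hA ih =>
    obtain ⟨B, h1, h2, h3, h4, h5⟩ := ih hE hEs hEc
    refine ⟨neg B, ⟨.neg h1.1, fun D hD => ?_⟩, .neg h2, .neg h3, ?_, ?_⟩
    · generalize hF : neg A = F at hD
      cases hD with
      | neg h =>
        obtain rfl := neg_injective hF
        rw [h1.2 _ h]
      | _ => exact absurd (congrArg head hF) (by simp)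
    · exact fun Y b h => occurs_neg_iff.2 (h4 Y _ (occurs_neg_iff.1 h))
    · intro ε hε
      rw [interp_neg, interp_neg, h5 ε hε]
  | pred φ =>
    refine ⟨pred φ, ⟨.pred φ, fun D hD => ?_⟩, .pred φ, .pred φ, fun _ _ h => h, fun _ _ => rfl⟩
    generalize hF : (pred φ : PreFormula S) = F at hD
    cases hD with
    | pred ψ => rfl
    | _ => exact absurd (congrArg head hF) (by simp)
  | var X =>
    refine ⟨var X, ⟨.var X, fun D hD => ?_⟩, .var X, .var X, fun _ _ h => h, fun _ _ => rfl⟩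
    generalize hF : (var X : PreFormula S) = F at hD
    cases hD with
    | var Y => rfl
    | _ => exact absurd (congrArg head hF) (by simp)
  | dia α A hA hA' ih =>
    obtain ⟨N, hN⟩ := id hEs
    obtain ⟨π, hd, hfr⟩ := exists_fresh_dia α hA.finSupp N
    have hα : Fresh (S.bn (π • α) : Set 𝒩) E := Fresh.of_supports hN hfr
    rw [← hd]
    obtain ⟨B, h1, h2, h3, h4, h5⟩ := ih π hE hEs hEc
    refine ⟨dia (π • α) B, ⟨.dia hα h1.1, fun D hD => ?_⟩, .dia _ h2, .dia _ h3, ?_, ?_⟩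
    · generalize hF : dia (π • α) (π • A) = F at hD
      cases hD with
      | dia hβ h => exact dia_eq_of_uniqueImage hR h1 h hF hα hβ
      | _ => exact absurd (congrArg head hF) (by simp)
    · exact fun Y b h => .dia (h4 Y b (occurs_dia_iff.1 h))
    · intro ε hε
      -- Freshness for the set `E` does not give freshness for `ε`. It does make `E` invariant under
      -- `ρ`, so `ρ⁻¹ • ε` is covered by the induction hypothesis.
      have key : ∀ ρ : NPerm 𝒩, (∀ a, ρ • a ≠ a → a ∈ S.bn (π • α) ∨ a ∉ N) →
          interp (ρ • B) ε = interp (ρ • π • A) ε := by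
        intro ρ hρ
        have hρE : ρ • E = E := hN ρ fun a ha => by
          by_contra hne
          exact (hρ a hne).elim (fun h => hfr a h ha) fun h => h ha
        have hm : ρ⁻¹ • ε ∈ E := by
          rwa [← Set.mem_smul_set_iff_inv_smul_mem, hρE]
        rw [interp_smul_left, h5 _ hm, ← interp_smul, smul_inv_smul]
      have hv := hE ε hε
      exact (interp_dia_subset h2.finSupp (hA' π).finSupp hv hv N fun ρ hρ =>
        (key ρ hρ).le).antisymm (interp_dia_subset (hA' π).finSupp h2.finSupp hv hv N
          fun ρ hρ => (key ρ hρ).ge)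
  | mu X A hpos hA ih =>
    obtain ⟨B, h1, h2, h3, h4, h5⟩ := ih (isValuation_extend hA.finSupp hE)
      (finSupp_extend hA.finSupp hEs) (mk_extend_lt hA hpos hE hEc)
    have hpos' : ¬ Occurs X false B := fun h => hpos (h4 _ _ h)
    -- With `γ` below `ν`, this bounds the limit disjunctions of the unrolling by `κ`.
    have hνκ : nu S ≤ κ := max_le (Order.succ_le_of_lt hκS) hκ.le
    obtain ⟨C, c1, c2, c3, c4, c5⟩ := exists_unroll hκ h2 hpos' h3 (Conv X B E)
      ((lt_ord.1 (Conv_lt h2 hpos' hE hEc)).trans_le hνκ)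
    refine ⟨C, ⟨.mu h1.1 c1.1, fun D hD => ?_⟩, c2, c3, fun Y b h => ?_, fun ε hε => ?_⟩
    · generalize hF : mu X A = F at hD
      cases hD with
      | mu hB hC =>
        obtain ⟨rfl, rfl⟩ := mu_inj hF
        rw [h1.2 _ hB] at hC
        exact c1.2 _ hC
      | _ => exact absurd (congrArg head hF) (by simp)
    · obtain ⟨hY, h⟩ := c4 Y b h
      exact .mu hY.symm (h4 Y b h)
    · have hv := hE ε hε
      rw [c5 ε hv, interp_mu_eq_iter hA hpos hv]
      exact iter_step_eq_of_agree hA hpos h2 hpos' hv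
        -- The valuations of the extended set are exactly the arguments at which agreement is
        -- required.
        (fun o ho => h5 _ ⟨ε, hε, o, ho, rfl⟩)
        (le_csSup (bddAbove_conv X B E) (Set.mem_image_of_mem _ hε))

/-! ### Validity in plain Hennessy-Milner logic. -/

theorem isValuation_const_empty : IsValuation (fun _ : ℕ => (∅ : Set S.State)) :=
  ⟨∅, fun π _ => by funext X; exact Set.smul_set_empty⟩

theorem fresh_const_empty (N : Set 𝒩) : Fresh N (fun _ : ℕ => (∅ : Set S.State)) :=
  Fresh.of_supports (M := ∅) (fun π _ => by funext X; exact Set.smul_set_empty) (by simp)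

theorem valid_conj {ι : Type u} {A : ι → PreFormula S} {P : S.State} :
    Valid P (conj A) ↔ ∀ i, Valid P (A i) := by
  have h2 : ∀ i, Valid P (A i) = Raw.Valid P (A i).out := fun i => by
    conv_lhs => rw [← mk_out (A i)]
    rfl
  change Raw.Valid P (Raw.conj ι fun i => (A i).out) ↔ _
  simp only [Raw.Valid, h2]

theorem valid_neg {A : PreFormula S} {P : S.State} : Valid P (neg A) ↔ ¬ Valid P A := by
  induction A using mk_ind with | _ R =>
  change Raw.Valid P (Raw.neg R) ↔ _
  simp only [Raw.Valid]
  rfl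

theorem valid_pred {φ : S.Pred} {P : S.State} : Valid P (pred φ) ↔ S.Entails P φ := by
  change Raw.Valid P (Raw.pred φ) ↔ _
  simp only [Raw.Valid]

theorem valid_dia {α : S.Act} {A : PreFormula S} {P : S.State} :
    Valid P (dia α A) ↔ ∃ α' A' P', dia α A = dia α' A' ∧ Fresh (S.bn α' : Set 𝒩) P ∧
      Step S P α' P' ∧ Valid P' A' := by
  induction A using mk_ind with | _ R =>
  change Raw.Valid P (Raw.dia α R) ↔ _
  simp only [Raw.Valid]
  constructor
  · rintro ⟨α', R', P', h, h'⟩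
    exact ⟨α', mk R', P', mk_eq_mk.2 h, h'⟩
  · rintro ⟨α', A', P', h, h'⟩
    induction A' using mk_ind with | _ R' =>
    exact ⟨α', R', P', mk_eq_mk.1 h, h'⟩

/-- Closed formulas without fixpoint operators are formulas of plain Hennessy-Milner logic. -/
theorem PreFormula.IsFormula.isHML {κ : Cardinal.{u}} {A : PreFormula S} (hA : IsFormula κ A)
    (hf : FixFree A) (hc : Closed A) : IsHML κ A := by
  induction hA with
  | conj hι hfs _ ih =>
    exact .conj hι hfs fun i =>
      ih i (fixFree_conj_iff.1 hf i) fun X ⟨b, h⟩ => hc X ⟨b, .conj i h⟩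
  | neg _ ih => exact .neg (ih (fixFree_neg_iff.1 hf) fun X ⟨b, h⟩ => hc X ⟨!b, .neg h⟩)
  | pred φ => exact .pred φ
  | dia α _ ih => exact .dia α (ih (fixFree_dia_iff.1 hf) fun X ⟨b, h⟩ => hc X ⟨b, .dia h⟩)
  | var X => exact absurd ⟨true, .var⟩ (hc X)
  | mu X _ _ _ => exact absurd hf not_fixFree_mu

/-- Validity agrees with the interpretation on closed formulas without fixpoint operators. -/
theorem valid_iff_mem_interp {κ : Cardinal.{u}} {A : PreFormula S} (hA : IsFormula κ A)
    (hf : FixFree A) (hc : Closed A) (P : S.State) :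
    Valid P A ↔ P ∈ interp A (fun _ => ∅) := by
  induction hA using isFormula_induction generalizing P with
  | conj A hι hfs hA ih =>
    rw [valid_conj, interp_conj, Set.mem_iInter]
    exact forall_congr' fun i =>
      ih i (fixFree_conj_iff.1 hf i) (fun X ⟨b, h⟩ => hc X ⟨b, .conj i h⟩) P
  | neg A hA ih =>
    rw [valid_neg, interp_neg, Set.mem_compl_iff,
      ih (fixFree_neg_iff.1 hf) (fun X ⟨b, h⟩ => hc X ⟨!b, .neg h⟩) P]
  | pred φ => rw [valid_pred, interp_pred]; rfl
  | var X => exact absurd ⟨true, .var⟩ (hc X)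
  | mu X A hpos hA ih => exact absurd hf not_fixFree_mu
  | dia α A hA hA' ih =>
    have ih' : ∀ (π : NPerm 𝒩) P, Valid P (π • A) ↔ P ∈ interp (π • A) (fun _ => ∅) :=
      fun π => ih π ((fixFree_dia_iff.1 hf).smul π)
        fun X ⟨b, h⟩ => hc X ⟨b, .dia (occurs_smul_iff.1 h)⟩
    -- The two clauses differ only in freshness for the valuation, which is automatic because the
    -- constant empty valuation has empty support.
    rw [valid_dia, mem_interp_dia]
    constructor
    · rintro ⟨α', A', P', h1, h2, h3, h4⟩
      obtain ⟨π, rfl, rfl, -⟩ := dia_eq_iff.1 h1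
      exact ⟨_, _, P', h1, h2, fresh_const_empty _, h3, (ih' π P').1 h4⟩
    · rintro ⟨α', A', P', h1, h2, -, h3, h4⟩
      obtain ⟨π, rfl, rfl, -⟩ := dia_eq_iff.1 h1
      exact ⟨_, _, P', h1, h2, h3, (ih' π P').2 h4⟩

end Encoding

end NomHML

/-! ### The main theorem. -/

theorem mainTheorem8 {𝒩 : Type u} [NameSpace 𝒩] (S : NTS 𝒩) (κ : Cardinal.{u})
    (hκ : ℵ₀ < κ) (hκS : #S.State < κ) :
    (∀ E : Set (ℕ → Set S.State), E.Nonempty → (∀ ε ∈ E, IsValuation ε) → FinSupp 𝒩 E →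
      #E < nu S →
      -- the encoding is a well-defined function on formulas
      (∀ A : PreFormula S, IsFormula κ A → ∃! B, Encodes E A B) ∧
      -- the unrollings that it uses stop at ordinals below `ν`
      (∀ (X : ℕ) (A B : PreFormula S), IsFormula κ (mu X A) → Encodes (extend X A E) A B →
        IsFormula κ (mu X B) ∧ Conv X B E < (nu S).ord) ∧
      -- encoded formulas are fixpoint-free and have the same interpretation
      (∀ A B : PreFormula S, IsFormula κ A → Encodes E A B →
        IsFormula κ B ∧ FixFree B ∧ (Closed A → IsHML κ B) ∧
        ∀ ε ∈ E, interp B ε = interp A ε)) ∧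
    -- every closed formula is equivalent to its encoding, a formula of plain HML
    (∀ A : PreFormula S, IsFormula κ A → Closed A →
      ∃ B, Encodes {fun _ => (∅ : Set S.State)} A B ∧ IsHML κ B ∧
        ∀ ε : ℕ → Set S.State, IsValuation ε → ∀ P : S.State,
          Valid P B ↔ P ∈ interp A ε) := by
  refine ⟨fun E _ hE hEs hEc => ⟨fun A hA => ?_, fun X A B hA hAB => ?_, fun A B hA hAB => ?_⟩,
    fun A hA hc => ?_⟩
  · obtain ⟨B, h, -⟩ := exists_encoding hκ hκS hA hE hEs hEc
    exact ⟨B, h.1, h.2⟩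
  · generalize hF : mu X A = F at hA
    cases hA with
    | mu Y hpos hA =>
      obtain ⟨rfl, rfl⟩ := mu_inj hF
      obtain ⟨B', h1, h2, -, h4, -⟩ := exists_encoding hκ hκS hA (isValuation_extend hA.finSupp hE)
        (finSupp_extend hA.finSupp hEs) (mk_extend_lt hA hpos hE hEc)
      obtain rfl := h1.2 _ hAB
      have hpos' : ¬ Occurs X false B := fun h => hpos (h4 _ _ h)
      exact ⟨.mu X hpos' h2, Conv_lt h2 hpos' hE hEc⟩
    | _ => exact absurd (congrArg head hF) (by simp)
  · obtain ⟨B', h1, h2, h3, h4, h5⟩ := exists_encoding hκ hκS hA hE hEs hEc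
    obtain rfl := h1.2 _ hAB
    exact ⟨h2, h3, fun hc => h2.isHML h3 fun Y ⟨b, h⟩ => hc Y ⟨b, h4 Y b h⟩, h5⟩
  · have hE : ∀ ε ∈ ({fun _ => (∅ : Set S.State)} : Set (ℕ → Set S.State)), IsValuation ε := by
      rintro _ rfl
      exact isValuation_const_empty
    have hEs : FinSupp 𝒩 ({fun _ => (∅ : Set S.State)} : Set (ℕ → Set S.State)) := by
      obtain ⟨N, hN⟩ := isValuation_const_empty (S := S)
      exact ⟨N, fun π hπ => by rw [Set.smul_set_singleton, hN π hπ]⟩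
    obtain ⟨B, h1, h2, h3, h4, h5⟩ := exists_encoding hκ hκS hA hE hEs
      (by rw [mk_singleton]; exact one_lt_aleph0.trans_le isRegular_nu.aleph0_le)
    have hcB : Closed B := fun Y ⟨b, h⟩ => hc Y ⟨b, h4 Y b h⟩
    refine ⟨B, h1.1, h2.isHML h3 hcB, fun ε hε P => ?_⟩
    -- Validity is compared with the interpretation at the empty valuation, the only one in this
    -- `E`; closedness of `A` then gives every other valuation.
    rw [valid_iff_mem_interp h2 h3 hcB, h5 _ rfl,
      hA.interp_eq_of_closed hc isValuation_const_empty hε]
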